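/- Let $\mathcal A$ be an abelian category. For $n\ge 1$ let $\mathrm{Ext}^n_{\mathcal A}(A,B)$ be the Yoneda group of exact $n$-fold sequences $0\to B\to Y_n\to\cdots\to Y_1\to A\to 0$, modulo the equivalence relation generated by morphisms of such sequences that are the identity on $A$ and $B$, with Baer sum as addition; morphisms act by pullback in $A$ and pushout in $B$. A pair $(\mathcal X,\mathcal Y)$ of classes of objects is a cotorsion pair if each class is the $\mathrm{Ext}^1_{\mathcal A}$-orthogonal of the other; it is complete if every object $A$ admits short exact sequences $0\to Y\to X\to A\to 0$ and $0\to A\to Y'\to X'\to 0$ with $X,X'\in\mathcal X$ and $Y,Y'\in\mathcal Y$; it is hereditary if $\mathrm{Ext}^i_{\mathcal A}(X,Y)=0$ for all $i\ge1$, $X\in\mathcal X$, $Y\in\mathcal Y$. Let $\mathfrak M=(\mathcal Q,\mathcal W,\mathcal R)$ be a hereditary abelian model structure on $\mathcal A$: $\mathcal W$ has the two-out-of-three property on short exact sequences, and both $(\mathcal Q,\mathcal R_{\mathcal W})$ and $(\mathcal Q_{\mathcal W},\mathcal R)$ are complete hereditary cotorsion pairs, where $\mathcal R_{\mathcal W}=\mathcal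 W\cap\mathcal R$ and $\mathcal Q_{\mathcal W}=\mathcal Q\cap\mathcal W$. For every object $A$ choose a cofibrant replacement $0\to F\to QA\to A\to 0$ with $QA\in\mathcal Q$, $F\in\mathcal R_{\mathcal W}$, and a fibrant replacement $0\to A\to RA\to T\to 0$ with $RA\in\mathcal R$, $T\in\mathcal Q_{\mathcal W}$; write $RQA=R(QA)$. An $\mathfrak M$-resolution of an object $X$ is an exact chain complex $W_X=(\cdots\to W_1\to W_0\to W_{-1}\to W_{-2}\to\cdots)$ whose differential $W_0\to W_{-1}$ is a composite $W_0\xrightarrow{\epsilon}X\xrightarrow{\eta}W_{-1}$ of an epimorphism and a monomorphism, such that $W_i\in\mathcal Q_{\mathcal W}$ for $i\ge0$, $W_i\in\mathcal R_{\mathcal W}$ for $i\le -1$, $\ker\epsilon$ and $\ker d_i$ ($i\ge1$) are in $\mathcal R$, and $\mathrm{cok}\,\eta$ and $\mathrm{cok}\,d_i$ ($i\le -1$) are in $\mathcal Q$. An $\mathfrak M$-coresolution $W^X$ is the same construction indexed cohomologically, with $\mathcal R_{\mathcal W}$-terms in degrees $\ge0$ and $\mathcal Q_{\mathcal W}$-terms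 in degrees $\le-1$, spliced as $W^{-1}\to X\to W^0$. The group $\mathrm{Ext}^n_{\mathrm{Ho}(\mathfrak M)}(A,B):=\mathrm{Ext}^n_{\mathfrak M}(RQA,RQB)$ is computed either as $H^n[\mathrm{Hom}_{\mathcal A}(W_{RQA},RQB)]$ or as $H^n[\mathrm{Hom}_{\mathcal A}(RQA,W^{RQB})]$, for any chosen $\mathfrak M$-resolution $W_{RQA}$ and $\mathfrak M$-coresolution $W^{RQB}$. Also set $\underline{\mathrm{Ext}}^n_{\mathrm{Ho}(\mathfrak M)}(A,B):=\mathrm{Ext}^n_{\mathcal A}(RQA,RQB)$. Then for all objects $A$, $B$ and each $n\ge1$ there are isomorphisms of abelian groups $$\mathrm{Ext}^n_{\mathrm{Ho}(\mathfrak M)}(A,B)\;\cong\;\underline{\mathrm{Ext}}^n_{\mathrm{Ho}(\mathfrak M)}(A,B)\;\cong\;\mathrm{Ext}^n_{\mathcal A}(QA,RB),$$ natural in $A$ and $B$, where the first isomorphism exists for each of the two computations of $\mathrm{Ext}^n_{\mathrm{Ho}(\mathfrak M)}(A,B)$. Precisely: the first isomorphism is compatible with all morphisms $a:RQA'\to RQA$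 and $b:RQB\to RQB'$ (acting on the Hom-complexes by composition and by any chain maps of (co)resolutions that extend $a$, respectively $b$); the second is compatible with all morphisms $f:A'\to A$ and $g:B\to B'$ of $\mathcal A$, acting through any lifts $Q(f)$, $R(Q(f))$, $R(Q(g))$ and $R(g)$ compatible with the replacement morphisms. -/

import Mathlib

open CategoryTheory CategoryTheory.Limits

universe v u

/-! ## Exact sequences of length `n` and Yoneda Ext -/

/-- A short exact sequence `0 ⟶ B ⟶ Y ⟶ A ⟶ 0` with prescribed ends. -/
structure ShortExtension {C : Type u} [Category.{v} C] [Abelian C] (A B : C) where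
  Y : C
  i : B ⟶ Y
  p : Y ⟶ A
  w : i ≫ p = 0
  exact : (ShortComplex.mk i p w).ShortExact

namespace ShortExtension

variable {C : Type u} [Category.{v} C] [Abelian C]

/-- The bottom row `0 ⟶ B' ⟶ Y ⊔_B B' ⟶ A ⟶ 0` of the pushout of a short exact sequence
along `b : B ⟶ B'`. -/
noncomputable def push {A B B' : C} (S : ShortExtension A B) (b : B ⟶ B') :
    ShortExtension A B' where
  Y := pushout S.i b
  i := pushout.inr S.i b
  p := pushout.desc S.p 0 (by rw [S.w, comp_zero])
  w := pushout.inr_desc _ _ _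
  exact := by
    have hm : Mono S.i := S.exact.mono_f
    have he : Epi S.p := S.exact.epi_g
    have e : Epi (pushout.desc (f := S.i) (g := b) S.p 0 (by rw [S.w, comp_zero])) :=
      epi_of_epi_fac (pushout.inl_desc _ _ _)
    refine ShortComplex.ShortExact.mk' ?_ (inferInstanceAs (Mono (pushout.inr S.i b))) e
    refine ShortComplex.exact_of_g_is_cokernel _ ?_
    have key : ∀ {Z : C} (k : pushout S.i b ⟶ Z), pushout.inr S.i b ≫ k = 0 →
        S.i ≫ (pushout.inl S.i b ≫ k) = 0 := by
      intro Z k hk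
      rw [← Category.assoc, pushout.condition, Category.assoc, hk, comp_zero]
    refine CokernelCofork.IsColimit.ofπ' _ _ (fun {Z} k hk =>
      ⟨S.exact.exact.desc (pushout.inl S.i b ≫ k) (key k hk), ?_⟩)
    refine pushout.hom_ext ?_ ?_
    · rw [← Category.assoc]
      erw [pushout.inl_desc]
      exact S.exact.exact.g_desc _ (key k hk)
    · rw [← Category.assoc]
      erw [pushout.inr_desc]
      rw [zero_comp]
      exact hk.symm

/-- The top row `0 ⟶ B ⟶ Y ×_A A' ⟶ A' ⟶ 0` of the pullback of a short exact sequence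
along `a : A' ⟶ A`. -/
noncomputable def pull {A A' B : C} (S : ShortExtension A B) (a : A' ⟶ A) :
    ShortExtension A' B where
  Y := pullback S.p a
  i := pullback.lift S.i 0 (by rw [S.w, zero_comp])
  p := pullback.snd S.p a
  w := pullback.lift_snd _ _ _
  exact := by
    have hm : Mono S.i := S.exact.mono_f
    have he : Epi S.p := S.exact.epi_g
    have e : Mono (pullback.lift (f := S.p) (g := a) S.i 0 (by rw [S.w, zero_comp])) :=
      mono_of_mono_fac (pullback.lift_fst _ _ _)
    refine ShortComplex.ShortExact.mk' ?_ e (inferInstanceAs (Epi (pullback.snd S.p a)))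
    refine ShortComplex.exact_of_f_is_kernel _ ?_
    have key : ∀ {Z : C} (k : Z ⟶ pullback S.p a), k ≫ pullback.snd S.p a = 0 →
        (k ≫ pullback.fst S.p a) ≫ S.p = 0 := by
      intro Z k hk
      rw [Category.assoc, pullback.condition, ← Category.assoc, hk, zero_comp]
    refine KernelFork.IsLimit.ofι' _ _ (fun {Z} k hk =>
      ⟨S.exact.exact.lift (k ≫ pullback.fst S.p a) (key k hk), ?_⟩)
    refine pullback.hom_ext ?_ ?_
    · rw [Category.assoc]
      erw [pullback.lift_fst]
      exact S.exact.exact.lift_f _ (key k hk)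
    · rw [Category.assoc]
      erw [pullback.lift_snd]
      rw [comp_zero]
      exact hk.symm

/-- The direct sum of two short exact sequences. -/
noncomputable def sum {A B A' B' : C} (S : ShortExtension A B) (T : ShortExtension A' B') :
    ShortExtension (A ⊞ A') (B ⊞ B') where
  Y := S.Y ⊞ T.Y
  i := biprod.map S.i T.i
  p := biprod.map S.p T.p
  w := by
    ext <;> simp [S.w, T.w]
  exact := by
    have hm : Mono S.i := S.exact.mono_f
    have he : Epi S.p := S.exact.epi_g
    have hm' : Mono T.i := T.exact.mono_f
    have he' : Epi T.p := T.exact.epi_g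
    refine ShortComplex.ShortExact.mk' ?_ (inferInstanceAs (Mono (biprod.map S.i T.i)))
      (inferInstanceAs (Epi (biprod.map S.p T.p)))
    refine ShortComplex.exact_of_f_is_kernel _ ?_
    have h1 : ∀ {Z : C} (k : Z ⟶ S.Y ⊞ T.Y), k ≫ biprod.map S.p T.p = 0 →
        (k ≫ biprod.fst) ≫ S.p = 0 := by
      intro Z k hk
      have := congrArg (· ≫ biprod.fst) hk
      simpa using this
    have h2 : ∀ {Z : C} (k : Z ⟶ S.Y ⊞ T.Y), k ≫ biprod.map S.p T.p = 0 →
        (k ≫ biprod.snd) ≫ T.p = 0 := by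
      intro Z k hk
      have := congrArg (· ≫ biprod.snd) hk
      simpa using this
    refine KernelFork.IsLimit.ofι' _ _ (fun {Z} k hk =>
      ⟨biprod.lift (S.exact.exact.lift (k ≫ biprod.fst) (h1 k hk))
        (T.exact.exact.lift (k ≫ biprod.snd) (h2 k hk)), ?_⟩)
    have e1 := S.exact.exact.lift_f _ (h1 k hk)
    have e2 := T.exact.exact.lift_f _ (h2 k hk)
    refine biprod.hom_ext _ _ ?_ ?_
    · simpa using e1
    · simpa using e2

/-- There is a morphism of short exact sequences from `S` to `S'` with the components
`b : B ⟶ B'` and `a : A ⟶ A'` at the two ends. -/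
def HasMorphism {A B A' B' : C} (a : A ⟶ A') (b : B ⟶ B') (S : ShortExtension A B)
    (S' : ShortExtension A' B') : Prop :=
  ∃ y : S.Y ⟶ S'.Y, S.i ≫ y = b ≫ S'.i ∧ S.p ≫ a = y ≫ S'.p

theorem HasMorphism.push {A B A' B₁ B₂ B₃ : C} {a : A ⟶ A'} {b : B ⟶ B₁}
    {S : ShortExtension A B} {S' : ShortExtension A' B₁} (hS : HasMorphism a b S S')
    (f : B ⟶ B₂) (g : B₁ ⟶ B₃) (h : B₂ ⟶ B₃) (w : f ≫ h = b ≫ g) :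
    HasMorphism a h (S.push f) (S'.push g) := by
  obtain ⟨y, h1, h2⟩ := hS
  have c : S.i ≫ y ≫ pushout.inl S'.i g = f ≫ h ≫ pushout.inr S'.i g := by
    rw [← Category.assoc, h1, Category.assoc, pushout.condition, ← Category.assoc,
      ← w, Category.assoc]
  have k1 : pushout.inr S.i f ≫ pushout.desc _ _ c = h ≫ pushout.inr S'.i g :=
    pushout.inr_desc _ _ _
  have k2 : pushout.desc S.p 0 (by rw [S.w, comp_zero]) ≫ a =
      pushout.desc _ _ c ≫ pushout.desc (f := S'.i) (g := g) S'.p 0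
        (by rw [S'.w, comp_zero]) := by
    refine pushout.hom_ext ?_ ?_
    · simp [pushout.inl_desc, pushout.inl_desc_assoc, h2]
    · simp [pushout.inr_desc, pushout.inr_desc_assoc]
  exact ⟨pushout.desc _ _ c, k1, k2⟩

theorem HasMorphism.pull {A B A₁ A₂ A₃ B' : C} {a : A ⟶ A₁} {b : B ⟶ B'}
    {S : ShortExtension A B} {S' : ShortExtension A₁ B'} (hS : HasMorphism a b S S')
    (f : A₂ ⟶ A) (g : A₃ ⟶ A₁) (h : A₂ ⟶ A₃) (w : f ≫ a = h ≫ g) :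
    HasMorphism h b (S.pull f) (S'.pull g) := by
  obtain ⟨y, h1, h2⟩ := hS
  have c : (pullback.fst S.p f ≫ y) ≫ S'.p = (pullback.snd S.p f ≫ h) ≫ g := by
    rw [Category.assoc, ← h2, ← Category.assoc, pullback.condition, Category.assoc, w,
      Category.assoc]
  have k1 : pullback.lift S.i 0 (by rw [S.w, zero_comp]) ≫ pullback.lift _ _ c =
      b ≫ pullback.lift (f := S'.p) (g := g) S'.i 0 (by rw [S'.w, zero_comp]) := by
    refine pullback.hom_ext ?_ ?_
    · simp [pullback.lift_fst, pullback.lift_fst_assoc, h1]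
    · simp [pullback.lift_snd, pullback.lift_snd_assoc]
  have k2 : pullback.snd S.p f ≫ h = pullback.lift _ _ c ≫ pullback.snd S'.p g :=
    (pullback.lift_snd _ _ _).symm
  exact ⟨pullback.lift _ _ c, k1, k2⟩

theorem HasMorphism.sum {A B A' B' A₁ B₁ A₁' B₁' : C}
    {a : A ⟶ A'} {b : B ⟶ B'} {a₁ : A₁ ⟶ A₁'} {b₁ : B₁ ⟶ B₁'}
    {S : ShortExtension A B} {S' : ShortExtension A' B'}
    {T : ShortExtension A₁ B₁} {T' : ShortExtension A₁' B₁'}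
    (hS : HasMorphism a b S S') (hT : HasMorphism a₁ b₁ T T') :
    HasMorphism (biprod.map a a₁) (biprod.map b b₁) (S.sum T) (S'.sum T') := by
  obtain ⟨y, h1, h2⟩ := hS
  obtain ⟨z, h3, h4⟩ := hT
  have k1 : biprod.map S.i T.i ≫ biprod.map y z =
      biprod.map b b₁ ≫ biprod.map S'.i T'.i := by
    ext <;> simp [h1, h3]
  have k2 : biprod.map S.p T.p ≫ biprod.map a a₁ =
      biprod.map y z ≫ biprod.map S'.p T'.p := by
    ext <;> simp [h2, h4]
  exact ⟨biprod.map y z, k1, k2⟩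

end ShortExtension

/-- `NFoldExtension n A B` is the type of exact `(n+1)`-fold sequences
`0 ⟶ B ⟶ Y_{n+1} ⟶ ⋯ ⟶ Y_1 ⟶ A ⟶ 0`, presented as the splice of the `n + 1` short exact
sequences into which they factor (so `n = 0` gives the short exact sequences;
in `splice S E` the sequence `S` is `0 ⟶ K ⟶ Y_1 ⟶ A ⟶ 0` and `E` is the exact sequence
`0 ⟶ B ⟶ Y_{n+2} ⟶ ⋯ ⟶ Y_2 ⟶ K ⟶ 0`). -/
inductive NFoldExtension {C : Type u} [Category.{v} C] [Abelian C] :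
    ℕ → C → C → Type (max u v) where
  | short {A B : C} (S : ShortExtension A B) : NFoldExtension 0 A B
  | splice {n : ℕ} {A K B : C} (S : ShortExtension A K) (E : NFoldExtension n K B) :
      NFoldExtension (n + 1) A B

namespace NFoldExtension

variable {C : Type u} [Category.{v} C] [Abelian C]

/-- There is a morphism of exact sequences from `E` to `E'` (a commutative ladder) with the
components `b : B ⟶ B'` and `a : A ⟶ A'` at the two ends. -/
def HasMorphism : ∀ {n : ℕ} {A B A' B' : C}, (A ⟶ A') → (B ⟶ B') →
    NFoldExtension n A B → NFoldExtension n A' B' → Prop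
  | 0, _, _, _, _, a, b, .short S, .short S' =>
      S.HasMorphism a b S'
  | _ + 1, _, _, _, _, a, b, .splice (K := K) S E, .splice (K := K') S' E' =>
      ∃ k : K ⟶ K', S.HasMorphism a k S' ∧ HasMorphism k b E E'

/-- The elementary relation generating Yoneda equivalence: a morphism of exact sequences which is
the identity on both ends. -/
def Rel {n : ℕ} {A B : C} (E E' : NFoldExtension n A B) : Prop :=
  HasMorphism (𝟙 A) (𝟙 B) E E'

/-- Pushout of an exact sequence along a morphism out of its left end. -/
noncomputable def push : ∀ {n : ℕ} {A B B' : C}, (B ⟶ B') →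
    NFoldExtension n A B → NFoldExtension n A B'
  | 0, _, _, _, b, .short S => .short (S.push b)
  | _ + 1, _, _, _, b, .splice S E => .splice S (push b E)

/-- Pullback of an exact sequence along a morphism into its right end. -/
noncomputable def pull {n : ℕ} {A A' B : C} (a : A' ⟶ A) :
    NFoldExtension n A B → NFoldExtension n A' B
  | .short S => .short (S.pull a)
  | .splice S E => .splice (S.pull a) E

/-- Direct sum of exact sequences. -/
noncomputable def sum : ∀ {n : ℕ} {A B A' B' : C},
    NFoldExtension n A B → NFoldExtension n A' B' → NFoldExtension n (A ⊞ A') (B ⊞ B')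
  | 0, _, _, _, _, .short S, .short S' => .short (S.sum S')
  | _ + 1, _, _, _, _, .splice S E, .splice S' E' => .splice (S.sum S') (sum E E')

theorem Rel.refl : ∀ {n : ℕ} {A B : C} (E : NFoldExtension n A B), Rel E E
  | 0, _, _, .short S => ⟨𝟙 _, by simp, by simp⟩
  | _ + 1, _, _, .splice S E => ⟨𝟙 _, ⟨𝟙 _, by simp, by simp⟩, Rel.refl E⟩

theorem HasMorphism.push : ∀ {n : ℕ} {A B A' B₁ B₂ B₃ : C} {a : A ⟶ A'} {b : B ⟶ B₁}
    {E : NFoldExtension n A B} {E' : NFoldExtension n A' B₁}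
    (_ : HasMorphism a b E E') (f : B ⟶ B₂) (g : B₁ ⟶ B₃) (h : B₂ ⟶ B₃)
    (_ : f ≫ h = b ≫ g), HasMorphism a h (E.push f) (E'.push g)
  | 0, _, _, _, _, _, _, _, _, .short _, .short _, hE, f, g, h, w =>
      ShortExtension.HasMorphism.push hE f g h w
  | _ + 1, _, _, _, _, _, _, _, _, .splice _ _, .splice _ _, hE, f, g, h, w => by
      obtain ⟨k, h1, h2⟩ := hE
      exact ⟨k, h1, HasMorphism.push h2 f g h w⟩

theorem HasMorphism.pull {n : ℕ} {A B A₁ A₂ A₃ B' : C} {a : A ⟶ A₁} {b : B ⟶ B'}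
    {E : NFoldExtension n A B} {E' : NFoldExtension n A₁ B'}
    (hE : HasMorphism a b E E') (f : A₂ ⟶ A) (g : A₃ ⟶ A₁) (h : A₂ ⟶ A₃)
    (w : f ≫ a = h ≫ g) : HasMorphism h b (E.pull f) (E'.pull g) := by
  cases E with
  | short S =>
    cases E' with
    | short S' => exact ShortExtension.HasMorphism.pull hE f g h w
  | splice S E =>
    cases E' with
    | splice S' E' =>
      obtain ⟨k, h1, h2⟩ := hE
      exact ⟨k, ShortExtension.HasMorphism.pull h1 f g h w, h2⟩

theorem HasMorphism.sum : ∀ {n : ℕ} {A B A' B' A₁ B₁ A₁' B₁' : C}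
    {a : A ⟶ A'} {b : B ⟶ B'} {a₁ : A₁ ⟶ A₁'} {b₁ : B₁ ⟶ B₁'}
    {E : NFoldExtension n A B} {E' : NFoldExtension n A' B'}
    {F : NFoldExtension n A₁ B₁} {F' : NFoldExtension n A₁' B₁'}
    (_ : HasMorphism a b E E') (_ : HasMorphism a₁ b₁ F F'),
    HasMorphism (biprod.map a a₁) (biprod.map b b₁) (E.sum F) (E'.sum F')
  | 0, _, _, _, _, _, _, _, _, _, _, _, _, .short _, .short _, .short _, .short _, hE, hF =>
      ShortExtension.HasMorphism.sum hE hF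
  | _ + 1, _, _, _, _, _, _, _, _, _, _, _, _, .splice _ _, .splice _ _, .splice _ _,
      .splice _ _, hE, hF => by
      obtain ⟨k, h1, h2⟩ := hE
      obtain ⟨l, h3, h4⟩ := hF
      exact ⟨biprod.map k l, ShortExtension.HasMorphism.sum h1 h3, HasMorphism.sum h2 h4⟩

theorem Rel.push {n : ℕ} {A B B' : C} {E E' : NFoldExtension n A B} (h : Rel E E')
    (b : B ⟶ B') : Rel (E.push b) (E'.push b) :=
  HasMorphism.push h b b (𝟙 _) (by simp)

theorem Rel.pull {n : ℕ} {A A' B : C} {E E' : NFoldExtension n A B} (h : Rel E E')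
    (a : A' ⟶ A) : Rel (E.pull a) (E'.pull a) :=
  HasMorphism.pull h a a (𝟙 _) (by simp)

theorem Rel.sum {n : ℕ} {A B A' B' : C} {E E' : NFoldExtension n A B}
    {F F' : NFoldExtension n A' B'} (h : Rel E E') (h' : Rel F F') :
    Rel (E.sum F) (E'.sum F') := by
  have := HasMorphism.sum h h'
  have e1 : biprod.map (𝟙 A) (𝟙 A') = 𝟙 (A ⊞ A') := by ext <;> simp
  have e2 : biprod.map (𝟙 B) (𝟙 B') = 𝟙 (B ⊞ B') := by ext <;> simp
  rwa [e1, e2] at this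

/-- The Baer sum of two exact sequences with the same ends: pull the direct sum back along the
diagonal of `A` and push it out along the codiagonal of `B`. -/
noncomputable def baerSum {n : ℕ} {A B : C} (E F : NFoldExtension n A B) :
    NFoldExtension n A B :=
  ((E.sum F).pull (biprod.lift (𝟙 A) (𝟙 A))).push (biprod.desc (𝟙 B) (𝟙 B))

theorem Rel.baerSum {n : ℕ} {A B : C} {E E' F F' : NFoldExtension n A B}
    (h : Rel E E') (h' : Rel F F') : Rel (E.baerSum F) (E'.baerSum F') :=
  ((h.sum h').pull _).push _

end NFoldExtension

/-- The Yoneda group `Ext^n(A, B)` for `n ≥ 1`: exact `n`-fold sequences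
`0 ⟶ B ⟶ Y_n ⟶ ⋯ ⟶ Y_1 ⟶ A ⟶ 0` modulo the equivalence relation generated by
`NFoldExtension.Rel`. (Only `n ≥ 1` is meaningful.) -/
def YonedaExt {C : Type u} [Category.{v} C] [Abelian C] (n : ℕ) (A B : C) : Type (max u v) :=
  Quot (NFoldExtension.Rel (n := n - 1) (A := A) (B := B))

namespace YonedaExt

variable {C : Type u} [Category.{v} C] [Abelian C]

/-- Addition in Yoneda `Ext` is the Baer sum. -/
noncomputable instance instAdd (n : ℕ) (A B : C) : Add (YonedaExt n A B) where
  add := Quot.map₂ NFoldExtension.baerSum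
    (fun E _ _ h => NFoldExtension.Rel.baerSum (NFoldExtension.Rel.refl E) h)
    (fun _ _ F h => NFoldExtension.Rel.baerSum h (NFoldExtension.Rel.refl F))

/-- The bifunctoriality of Yoneda `Ext`: pull back along `a : A' ⟶ A`, push out along
`b : B ⟶ B'`. -/
noncomputable def map {n : ℕ} {A A' B B' : C} (a : A' ⟶ A) (b : B ⟶ B') :
    YonedaExt n A B → YonedaExt n A' B' :=
  Quot.map (fun E => (E.pull a).push b) (fun _ _ h => (h.pull a).push b)

end YonedaExt

/-! ## Cotorsion pairs and abelian model structures -/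

section Cotorsion

variable {C : Type u} [Category.{v} C] [Abelian C]

/-- `(X, Y)` is a cotorsion pair: `Y = X^⊥` and `X = ^⊥Y` with respect to `Ext¹`. -/
structure IsCotorsionPair (X Y : ObjectProperty C) : Prop where
  right_iff : ∀ B : C, Y B ↔ ∀ A : C, X A → Subsingleton (YonedaExt 1 A B)
  left_iff : ∀ A : C, X A ↔ ∀ B : C, Y B → Subsingleton (YonedaExt 1 A B)

/-- A complete cotorsion pair: every `A` admits short exact sequences `0 ⟶ Y ⟶ X ⟶ A ⟶ 0` and
`0 ⟶ A ⟶ Y' ⟶ X' ⟶ 0` with `X`, `X'` in the left class and `Y`, `Y'` in the right class. -/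
structure IsCompleteCotorsionPair (X Y : ObjectProperty C) : Prop
    extends IsCotorsionPair X Y where
  enough_projectives : ∀ A : C, ∃ (P : C) (p : P ⟶ A), Epi p ∧ X P ∧ Y (kernel p)
  enough_injectives : ∀ A : C, ∃ (I : C) (i : A ⟶ I), Mono i ∧ Y I ∧ X (cokernel i)

/-- The condition defining hereditary cotorsion pairs: `Ext^i(A, B) = 0` for all `i ≥ 1`, `A` in
the left class, `B` in the right class. -/
def IsHereditaryPair (X Y : ObjectProperty C) : Prop :=
  ∀ A B : C, X A → Y B → ∀ i : ℕ, 1 ≤ i → Subsingleton (YonedaExt i A B)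

end Cotorsion

/-- An abelian model structure on `C`, given as a triple of classes of objects (cofibrant, trivial
and fibrant objects). -/
structure AbelianModelStructure (C : Type u) [Category.{v} C] [Abelian C] where
  Q : ObjectProperty C
  W : ObjectProperty C
  R : ObjectProperty C
  /-- `W` has the two out of three property on short exact sequences. -/
  thick₁ : ∀ S : ShortComplex C, S.ShortExact → W S.X₂ → W S.X₃ → W S.X₁
  thick₂ : ∀ S : ShortComplex C, S.ShortExact → W S.X₁ → W S.X₃ → W S.X₂
  thick₃ : ∀ S : ShortComplex C, S.ShortExact → W S.X₁ → W S.X₂ → W S.X₃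
  left_pair : IsCompleteCotorsionPair Q (W ⊓ R)
  right_pair : IsCompleteCotorsionPair (Q ⊓ W) R

namespace AbelianModelStructure

variable {C : Type u} [Category.{v} C] [Abelian C] (M : AbelianModelStructure C)

/-- Trivially cofibrant objects. -/
abbrev QW : ObjectProperty C := M.Q ⊓ M.W

/-- Trivially fibrant objects. -/
abbrev RW : ObjectProperty C := M.W ⊓ M.R

/-- The model structure is hereditary if both its cotorsion pairs are. -/
def IsHereditary : Prop :=
  IsHereditaryPair M.Q M.RW ∧ IsHereditaryPair M.QW M.R

/-- A cofibrant replacement of `A`: `0 ⟶ F ⟶ QA ⟶ A ⟶ 0` with `QA` cofibrant and `F` trivially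
fibrant. -/
structure CofibrantReplacement (A : C) where
  obj : C
  p : obj ⟶ A
  epi : Epi p
  cofibrant : M.Q obj
  trivFib : M.RW (kernel p)

/-- A fibrant replacement of `A`: `0 ⟶ A ⟶ RA ⟶ T ⟶ 0` with `RA` fibrant and `T` trivially
cofibrant. -/
structure FibrantReplacement (A : C) where
  obj : C
  j : A ⟶ obj
  mono : Mono j
  fibrant : M.R obj
  trivCof : M.QW (cokernel j)

/-- A full resolution `⋯ ⟶ W₁ ⟶ W₀ ⟶ W₋₁ ⟶ W₋₂ ⟶ ⋯` of `A`, where `W₀ ⟶ W₋₁` is the composite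
`W₀ ⟶ A ⟶ W₋₁` of an epimorphism and a monomorphism, such that the left half is built from the
pair `(QW, R)` and the right half from the pair `(Q, RW)`. -/
structure Resolution (A : C) where
  complex : ChainComplex C ℤ
  ε : complex.X 0 ⟶ A
  η : A ⟶ complex.X (-1)
  epi : Epi ε
  mono : Mono η
  fac : complex.d 0 (-1) = ε ≫ η
  exact : ∀ i : ℤ, complex.ExactAt i
  trivCof : ∀ i : ℤ, 0 ≤ i → M.QW (complex.X i)
  trivFib : ∀ i : ℤ, i ≤ -1 → M.RW (complex.X i)
  ker_ε : M.R (kernel ε)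
  ker_d : ∀ i : ℤ, 1 ≤ i → M.R (kernel (complex.d i (i - 1)))
  coker_η : M.Q (cokernel η)
  coker_d : ∀ i : ℤ, i ≤ -1 → M.Q (cokernel (complex.d i (i - 1)))

/-- A full coresolution `⋯ ⟶ W⁻² ⟶ W⁻¹ ⟶ W⁰ ⟶ W¹ ⟶ ⋯` of `A`, where `W⁻¹ ⟶ W⁰` is the composite
`W⁻¹ ⟶ A ⟶ W⁰` of an epimorphism and a monomorphism, such that the left half is built from the
pair `(QW, R)` and the right half from the pair `(Q, RW)`. -/
structure Coresolution (A : C) where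
  complex : CochainComplex C ℤ
  ε : complex.X (-1) ⟶ A
  η : A ⟶ complex.X 0
  epi : Epi ε
  mono : Mono η
  fac : complex.d (-1) 0 = ε ≫ η
  exact : ∀ i : ℤ, complex.ExactAt i
  trivCof : ∀ i : ℤ, i ≤ -1 → M.QW (complex.X i)
  trivFib : ∀ i : ℤ, 0 ≤ i → M.RW (complex.X i)
  ker_ε : M.R (kernel ε)
  ker_d : ∀ i : ℤ, i ≤ -2 → M.R (kernel (complex.d i (i + 1)))
  coker_η : M.Q (cokernel η)
  coker_d : ∀ i : ℤ, 0 ≤ i → M.Q (cokernel (complex.d i (i + 1)))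

variable {M}

/-- The chain map `α` extends the morphism `f`. -/
def Resolution.Extends {A B : C} (W : M.Resolution A) (W' : M.Resolution B)
    (f : A ⟶ B) (α : W.complex ⟶ W'.complex) : Prop :=
  α.f 0 ≫ W'.ε = W.ε ≫ f ∧ f ≫ W'.η = W.η ≫ α.f (-1)

/-- The cochain map `α` extends the morphism `f`. -/
def Coresolution.Extends {A B : C} (W : M.Coresolution A) (W' : M.Coresolution B)
    (f : A ⟶ B) (α : W.complex ⟶ W'.complex) : Prop :=
  α.f (-1) ≫ W'.ε = W.ε ≫ f ∧ f ≫ W'.η = W.η ≫ α.f 0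

end AbelianModelStructure

/-! ## Cohomology of Hom complexes -/

section HomCohomology

variable {C : Type u} [Category.{v} C] [Abelian C]

/-- Degree `n` cocycles of the cochain complex `Hom(K, B)`. -/
def leftCocycles (n : ℤ) (K : ChainComplex C ℤ) (B : C) : AddSubgroup (K.X n ⟶ B) where
  carrier := {f | K.d (n + 1) n ≫ f = 0}
  zero_mem' := by simp
  add_mem' := by
    intro f g hf hg
    simp only [Set.mem_ofPred_eq] at hf hg ⊢
    rw [Preadditive.comp_add, hf, hg, add_zero]
  neg_mem' := by
    intro f hf
    simp only [Set.mem_ofPred_eq] at hf ⊢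
    rw [Preadditive.comp_neg, hf, neg_zero]

/-- Degree `n` coboundaries of the cochain complex `Hom(K, B)`. -/
def leftCoboundaries (n : ℤ) (K : ChainComplex C ℤ) (B : C) : AddSubgroup (K.X n ⟶ B) where
  carrier := {f | ∃ g : K.X (n - 1) ⟶ B, K.d n (n - 1) ≫ g = f}
  zero_mem' := ⟨0, by simp⟩
  add_mem' := by
    rintro _ _ ⟨g, rfl⟩ ⟨h, rfl⟩
    exact ⟨g + h, by simp⟩
  neg_mem' := by
    rintro _ ⟨g, rfl⟩
    exact ⟨-g, by simp⟩

/-- `H^n[Hom(K, B)]`. -/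
abbrev LeftHomCohomology (n : ℤ) (K : ChainComplex C ℤ) (B : C) : Type v :=
  leftCocycles n K B ⧸ (leftCoboundaries n K B).addSubgroupOf (leftCocycles n K B)

/-- The map on cocycles induced by a chain map and a morphism of `C`. -/
def leftCocyclesMap (n : ℤ) {K K' : ChainComplex C ℤ} {B B' : C} (α : K' ⟶ K) (b : B ⟶ B') :
    leftCocycles n K B →+ leftCocycles n K' B' where
  toFun f := ⟨α.f n ≫ f.1 ≫ b, by
    have hf : K.d (n + 1) n ≫ f.1 = 0 := f.2
    change K'.d (n + 1) n ≫ α.f n ≫ f.1 ≫ b = 0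
    rw [← Category.assoc, ← α.comm, Category.assoc, ← Category.assoc (K.d _ _), hf, zero_comp,
      comp_zero]⟩
  map_zero' := by ext; simp
  map_add' f g := by ext; simp

/-- The homomorphism `H^n[Hom(K, B)] → H^n[Hom(K', B')]` induced by a chain map `K' ⟶ K` and a
morphism `B ⟶ B'`. -/
def LeftHomCohomology.map (n : ℤ) {K K' : ChainComplex C ℤ} {B B' : C} (α : K' ⟶ K)
    (b : B ⟶ B') : LeftHomCohomology n K B →+ LeftHomCohomology n K' B' :=
  QuotientAddGroup.map _ _ (leftCocyclesMap n α b) (by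
    rintro ⟨f, hf⟩ ⟨g, hg⟩
    refine ⟨α.f (n - 1) ≫ g ≫ b, ?_⟩
    have hg' : K.d n (n - 1) ≫ g = f := hg
    change K'.d n (n - 1) ≫ α.f (n - 1) ≫ g ≫ b = α.f n ≫ f ≫ b
    rw [← hg']
    simp)

/-- Degree `n` cocycles of the cochain complex `Hom(A, K)`. -/
def rightCocycles (n : ℤ) (A : C) (K : CochainComplex C ℤ) : AddSubgroup (A ⟶ K.X n) where
  carrier := {f | f ≫ K.d n (n + 1) = 0}
  zero_mem' := by simp
  add_mem' := by
    intro f g hf hg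
    simp only [Set.mem_ofPred_eq] at hf hg ⊢
    rw [Preadditive.add_comp, hf, hg, add_zero]
  neg_mem' := by
    intro f hf
    simp only [Set.mem_ofPred_eq] at hf ⊢
    rw [Preadditive.neg_comp, hf, neg_zero]

/-- Degree `n` coboundaries of the cochain complex `Hom(A, K)`. -/
def rightCoboundaries (n : ℤ) (A : C) (K : CochainComplex C ℤ) : AddSubgroup (A ⟶ K.X n) where
  carrier := {f | ∃ g : A ⟶ K.X (n - 1), g ≫ K.d (n - 1) n = f}
  zero_mem' := ⟨0, by simp⟩
  add_mem' := by
    rintro _ _ ⟨g, rfl⟩ ⟨h, rfl⟩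
    exact ⟨g + h, by simp⟩
  neg_mem' := by
    rintro _ ⟨g, rfl⟩
    exact ⟨-g, by simp⟩

/-- `H^n[Hom(A, K)]`. -/
abbrev RightHomCohomology (n : ℤ) (A : C) (K : CochainComplex C ℤ) : Type v :=
  rightCocycles n A K ⧸ (rightCoboundaries n A K).addSubgroupOf (rightCocycles n A K)

/-- The map on cocycles induced by a morphism of `C` and a cochain map. -/
def rightCocyclesMap (n : ℤ) {A A' : C} {K K' : CochainComplex C ℤ} (a : A' ⟶ A) (β : K ⟶ K') :
    rightCocycles n A K →+ rightCocycles n A' K' where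
  toFun f := ⟨a ≫ f.1 ≫ β.f n, by
    have hf : f.1 ≫ K.d n (n + 1) = 0 := f.2
    change (a ≫ f.1 ≫ β.f n) ≫ K'.d n (n + 1) = 0
    rw [Category.assoc, Category.assoc, β.comm, ← Category.assoc f.1, hf, zero_comp, comp_zero]⟩
  map_zero' := by ext; simp
  map_add' f g := by ext; simp

/-- The homomorphism `H^n[Hom(A, K)] → H^n[Hom(A', K')]` induced by a morphism `A' ⟶ A` and a
cochain map `K ⟶ K'`. -/
def RightHomCohomology.map (n : ℤ) {A A' : C} {K K' : CochainComplex C ℤ} (a : A' ⟶ A)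
    (β : K ⟶ K') : RightHomCohomology n A K →+ RightHomCohomology n A' K' :=
  QuotientAddGroup.map _ _ (rightCocyclesMap n a β) (by
    rintro ⟨f, hf⟩ ⟨g, hg⟩
    refine ⟨a ≫ g ≫ β.f (n - 1), ?_⟩
    have hg' : g ≫ K.d (n - 1) n = f := hg
    change (a ≫ g ≫ β.f (n - 1)) ≫ K'.d (n - 1) n = a ≫ f ≫ β.f n
    rw [← hg']
    simp)

end HomCohomology

/-! ## The Ext groups of the homotopy category -/

namespace AbelianModelStructure

variable {C : Type u} [Category.{v} C] [Abelian C]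

/-- A choice, for every object, of a cofibrant replacement `QA`, a fibrant replacement `RA`, and of
a canonical resolution and a canonical coresolution of the bifibrant replacement `RQA`. -/
structure ReplacementSystem (M : AbelianModelStructure C) where
  cof : ∀ A : C, M.CofibrantReplacement A
  fib : ∀ A : C, M.FibrantReplacement A
  res : ∀ A : C, M.Resolution (fib (cof A).obj).obj
  cores : ∀ A : C, M.Coresolution (fib (cof A).obj).obj

namespace ReplacementSystem

variable {M : AbelianModelStructure C} (D : M.ReplacementSystem)

/-- The cofibrant replacement `QA`. -/
abbrev Q (A : C) : C := (D.cof A).obj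

/-- The fibrant replacement `RA`. -/
abbrev R (A : C) : C := (D.fib A).obj

/-- `Ext^n_{Ho(M)}(A, B) = Ext^n_M(RQA, RQB)`, computed as `H^n[Hom(W_{RQA}, RQB)]` from the
resolution of `RQA`. -/
abbrev LeftExtHo (n : ℤ) (A B : C) : Type v :=
  LeftHomCohomology n (D.res A).complex (D.R (D.Q B))

/-- `Ext^n_{Ho(M)}(A, B) = Ext^n_M(RQA, RQB)`, computed as `H^n[Hom(RQA, W^{RQB})]` from the
coresolution of `RQB`. -/
abbrev RightExtHo (n : ℤ) (A B : C) : Type v :=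
  RightHomCohomology n (D.R (D.Q A)) (D.cores B).complex

/-- The version `Ext^n(RQA, RQB)` defined from Yoneda `Ext`. -/
abbrev YonedaExtHo (n : ℕ) (A B : C) : Type (max u v) :=
  YonedaExt n (D.R (D.Q A)) (D.R (D.Q B))

/-- `q` and `rq` are representatives of `Q(f)` and `R(Q(f))`. -/
def IsBifibrantLift {A A' : C} (f : A ⟶ A') (q : D.Q A ⟶ D.Q A')
    (rq : D.R (D.Q A) ⟶ D.R (D.Q A')) : Prop :=
  q ≫ (D.cof A').p = (D.cof A).p ≫ f ∧ (D.fib (D.Q A)).j ≫ rq = q ≫ (D.fib (D.Q A')).j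

/-- `r` is a representative of `R(g)`. -/
def IsFibrantLift {B B' : C} (g : B ⟶ B') (r : D.R B ⟶ D.R B') : Prop :=
  (D.fib B).j ≫ r = g ≫ (D.fib B').j

end ReplacementSystem

end AbelianModelStructure

-- All groups are compared inside `Abelian.Ext`, the Ext of the derived category, where long exact
-- sequences are available and no enough-projectives hypothesis is needed.
--
-- Yoneda Ext agrees with it (`YonedaExt.extEquiv`): an exact sequence is sent to the product of the
-- classes of its short exact pieces. Bijectivity rests on effaceability: every class of positive
-- degree dies after pullback along some epimorphism (`exists_epi_comp_eq_zero`).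
--
-- For the first isomorphism, heredity gives Ext^i(W_k, RQB) = 0 for i ≥ 1 and k ≥ 0, because W_k is
-- trivially cofibrant and RQB is fibrant. Hence the nonnegative half of an 𝔐-resolution of RQA
-- computes Ext(RQA, RQB) by dimension shifting (`leftHomCohomologyEquiv`). In degrees n ≥ 1 the
-- negative half serves only to identify W_0/B_0 with RQA. The coresolution case is dual and uses
-- that RQA is cofibrant.
--
-- For the second isomorphism, QA ⟶ RQA has trivially cofibrant cokernel, so it induces isomorphisms
-- on positive Ext into the fibrant object RB. A comparison RQB ⟶ RB factors through the pushout V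
-- of RQB ⟵ QB ⟶ B. The map RQB ⟶ V is an epimorphism with trivially fibrant kernel, while V and RB
-- are two fibrant replacements of B. Both factors are therefore isomorphisms on positive Ext from
-- cofibrant objects. Independence of choices, and with it naturality for arbitrary lifts, comes
-- from `comp_mk₀_eq_zero`: a map to a fibrant object that vanishes on a subobject with trivially
-- cofibrant quotient factors through a trivially fibrant object.

universe w v₁ u₁

/-! ### Effaceability and functoriality of Ext in the derived category -/

section

open HomologicalComplex in
/-- A quasi-isomorphism from a complex concentrated in degrees `≤ i` to an object placed in
degree `i` is an epimorphism in degree `i`. -/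
lemma CochainComplex.epi_f_of_quasiIsoAt_single {C : Type u₁} [Category.{v₁} C] [Abelian C]
    {A : C} {K : CochainComplex C ℤ} {i : ℤ}
    (π : K ⟶ (single C (ComplexShape.up ℤ) i).obj A) [K.IsStrictlyLE i] [QuasiIsoAt π i] :
    Epi (π.f i) := by
  -- As K vanishes in degree i + 1, every element of degree i is a cycle. So `π.f i` is, up to
  -- isomorphisms, the projection onto homology followed by the isomorphism induced by π.
  let e := K.iCyclesIso i (i + 1) (by simp)
    ((K.isZero_of_isStrictlyLE i (i + 1) (by simp)).eq_of_tgt _ _)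
  have : π.f i = (e.inv ≫ K.homologyπ i ≫ homologyMap π i ≫
      (singleObjHomologySelfIso _ _ _).hom) ≫ (singleObjXSelf (ComplexShape.up ℤ) i A).inv := by
    rw [← cancel_epi e.hom, Category.assoc, Category.assoc, Category.assoc,
      Iso.hom_inv_id_assoc, homologyπ_naturality_assoc, homologyπ_singleObjHomologySelfIso_hom_assoc,
      ← singleObjCyclesSelfIso_inv_iCycles, Iso.hom_inv_id_assoc, cyclesMap_i]
    rfl
  rw [this]
  have (X : C) (f : K.X i ⟶ A) [Epi f] (g : A ≅ X) : Epi (f ≫ g.hom) := inferInstance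
  exact this _ _ (singleObjXSelf (ComplexShape.up ℤ) i A).symm

variable {C : Type u₁} [Category.{v₁} C] [Abelian C] [HasExt.{w} C]

open DerivedCategory HomologicalComplex

namespace CategoryTheory.Abelian.Ext

/-- Every class of positive degree is killed by an epimorphism. -/
lemma exists_epi_comp_eq_zero {A B : C} {n : ℕ} (e : Ext A B (n + 1)) :
    ∃ (P : C) (p : P ⟶ A), Epi p ∧ (Ext.mk₀ p).comp e (zero_add _) = 0 := by
  let := HasDerivedCategory.standard C
  -- The shift of B is rewritten as B placed in degree -(n + 1), so that its vanishing in degree 0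
  -- is visible.
  let φ : Q.obj ((single C (ComplexShape.up ℤ) 0).obj A) ⟶
    Q.obj ((single C (ComplexShape.up ℤ) (-(n + 1))).obj B) :=
    e.hom ≫ ((singleFunctors C).shiftIso (n + 1) (-(n + 1)) 0 (by lia)).hom.app _
  -- Calculus of fractions gives φ = Q(π)⁻¹ ≫ Q(g) with K zero in positive degrees. The required
  -- epimorphism is the degree 0 part of π: it lifts through K as ι ≫ π, and ι ≫ g = 0 for degree
  -- reasons.
  obtain ⟨K, hK, π, h, g, hg⟩ := right_fac_of_isStrictlyLE φ 0
  let ι : (single C (ComplexShape.up ℤ) 0).obj (K.X 0) ⟶ K :=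
    mkHomFromSingle (𝟙 _) (by
      rintro _ rfl
      apply (K.isZero_of_isStrictlyLE 0 (0 + 1) (by simp)).eq_of_tgt)
  have hπ : Epi (π.f 0) := by
    rw [isIso_Q_map_iff_quasiIso] at h
    exact CochainComplex.epi_f_of_quasiIsoAt_single π
  let p : K.X 0 ⟶ A := π.f 0 ≫ (singleObjXSelf (ComplexShape.up ℤ) 0 A).hom
  have hp : Epi p := epi_comp _ _
  have h₁ : (single C (ComplexShape.up ℤ) 0).map p = ι ≫ π := by
    apply HomologicalComplex.from_single_hom_ext
    rw [single_map_f_self, comp_f, mkHomFromSingle_f]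
    simp only [p, Category.assoc, Iso.hom_inv_id, Category.comp_id]
  have h₂ : ι ≫ g = 0 := by
    apply HomologicalComplex.from_single_hom_ext
    apply (CochainComplex.isZero_of_isStrictlyLE _ (-((n : ℤ) + 1)) 0 (by lia)).eq_of_tgt
  have h₃ : Q.map ((single C (ComplexShape.up ℤ) 0).map p) ≫ φ = 0 := by
    rw [h₁, hg, Functor.map_comp, Category.assoc, IsIso.hom_inv_id_assoc, ← Functor.map_comp, h₂,
      Functor.map_zero]
  refine ⟨K.X 0, p, hp, Ext.homEquiv.injective ?_⟩
  rw [← cancel_mono (((singleFunctors C).shiftIso (n + 1) (-(n + 1)) 0 (by lia)).hom.app _)]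
  change ((Ext.mk₀ p).comp e (zero_add _)).hom ≫ _ = Ext.hom 0 ≫ _
  rw [← Ext.singleFunctor_map_comp_hom, Category.assoc, Ext.zero_hom, Limits.zero_comp]
  exact h₃

/-- The action of a pair of morphisms on `Ext`. -/
noncomputable def bimap {A A' B B' : C} (a : A' ⟶ A) (b : B ⟶ B')
    (n : ℕ) : Ext.{w} A B n →+ Ext.{w} A' B' n :=
  ((Ext.mk₀ a).precomp B' (zero_add n)).comp ((Ext.mk₀ b).postcomp A (add_zero n))

lemma bimap_apply {A A' B B' : C} (a : A' ⟶ A) (b : B ⟶ B') {n : ℕ}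
    (x : Ext.{w} A B n) :
    bimap a b n x = (Ext.mk₀ a).comp (x.comp (Ext.mk₀ b) (add_zero n)) (zero_add n) := rfl

lemma bimap_bimap {A A' A'' B B' B'' : C} (a : A' ⟶ A) (b : B ⟶ B')
    (a' : A'' ⟶ A') (b' : B' ⟶ B'') {n : ℕ} (x : Ext.{w} A B n) :
    bimap a' b' n (bimap a b n x) = bimap (a' ≫ a) (b ≫ b') n x := by
  simp only [bimap_apply, ← Ext.mk₀_comp_mk₀, Ext.comp_assoc_of_third_deg_zero,
    Ext.comp_assoc (Ext.mk₀ a') (Ext.mk₀ a) _ (zero_add 0) (zero_add n) (zero_add n)]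

lemma bimap_id {A B : C} {n : ℕ} (x : Ext.{w} A B n) :
    bimap (𝟙 A) (𝟙 B) n x = x := by
  rw [bimap_apply, Ext.mk₀_id_comp, Ext.comp_mk₀_id]

/-- The isomorphism of `Ext` groups induced by a pair of isomorphisms. -/
noncomputable def bimapEquiv {A A' B B' : C} (a : A' ≅ A) (b : B ≅ B')
    (n : ℕ) : Ext.{w} A B n ≃+ Ext.{w} A' B' n where
  __ := bimap a.hom b.hom n
  invFun := bimap a.inv b.inv n
  left_inv x := by
    refine (bimap_bimap _ _ _ _ x).trans ?_
    rw [a.inv_hom_id, b.hom_inv_id, bimap_id]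
  right_inv x := by
    refine (bimap_bimap _ _ _ _ x).trans ?_
    rw [a.hom_inv_id, b.inv_hom_id, bimap_id]

end CategoryTheory.Abelian.Ext

end

/-! ### Comparison of Yoneda Ext with Ext in the derived category -/

section

variable {C : Type u₁} [Category.{v₁} C] [Abelian C]

namespace ShortExtension

/-- The short exact sequence given by an epimorphism and its kernel. -/
noncomputable def ofEpi {P A : C} (p : P ⟶ A) [Epi p] : ShortExtension A (kernel p) where
  Y := P
  i := kernel.ι p
  p := p
  w := kernel.condition p
  exact := ShortComplex.ShortExact.mk' (ShortComplex.exact_kernel p) inferInstance ‹_›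

/-- The short exact sequence given by a monomorphism and its cokernel. -/
noncomputable def ofMono {B I : C} (i : B ⟶ I) [Mono i] : ShortExtension (cokernel i) B where
  Y := I
  i := i
  p := cokernel.π i
  w := cokernel.condition i
  exact := ShortComplex.ShortExact.mk' (ShortComplex.exact_cokernel i) ‹_› inferInstance

lemma hasMorphism_pull {A A' B : C} (S : ShortExtension A B) (a : A' ⟶ A) :
    HasMorphism a (𝟙 B) (S.pull a) S :=
  ⟨pullback.fst S.p a, (pullback.lift_fst _ _ _).trans (Category.id_comp _).symm,
    pullback.condition.symm⟩

lemma hasMorphism_push {A B B' : C} (S : ShortExtension A B) (b : B ⟶ B') :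
    HasMorphism (𝟙 A) b S (S.push b) :=
  ⟨pushout.inl S.i b, pushout.condition,
    (Category.comp_id _).trans (pushout.inl_desc _ _ _).symm⟩

/-- A morphism between the middle terms over a morphism of the right ends extends to a morphism of
short exact sequences. -/
lemma exists_hasMorphism {A B A' B' : C} (S : ShortExtension A B) (S' : ShortExtension A' B')
    (a : A ⟶ A') (y : S.Y ⟶ S'.Y) (h : S.p ≫ a = y ≫ S'.p) :
    ∃ b : B ⟶ B', S.i ≫ y = b ≫ S'.i ∧ HasMorphism a b S S' := by
  have := S'.exact.mono_f
  have hw : (S.i ≫ y) ≫ S'.p = 0 := by rw [Category.assoc, ← h, ← Category.assoc, S.w, zero_comp]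
  have hl : S.i ≫ y = S'.exact.exact.lift (S.i ≫ y) hw ≫ S'.i :=
    (S'.exact.exact.lift_f (S.i ≫ y) hw).symm
  exact ⟨_, hl, y, hl, h⟩

/-- Two short exact sequences with the same right end are dominated by a third one. -/
lemma exists_common_domination {A B B' : C} (S : ShortExtension A B) (S' : ShortExtension A B') :
    ∃ (K : C) (T : ShortExtension A K) (k : K ⟶ B) (k' : K ⟶ B'),
      HasMorphism (𝟙 A) k T S ∧ HasMorphism (𝟙 A) k' T S' := by
  have : Epi S.p := S.exact.epi_g
  have : Epi S'.p := S'.exact.epi_g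
  have : Epi (pullback.fst S.p S'.p ≫ S.p) := epi_comp _ _
  let T := ofEpi (pullback.fst S.p S'.p ≫ S.p)
  obtain ⟨k, -, hk⟩ := exists_hasMorphism T S (𝟙 A) (pullback.fst S.p S'.p)
    (Category.comp_id _)
  obtain ⟨k', -, hk'⟩ := exists_hasMorphism T S' (𝟙 A) (pullback.snd S.p S'.p)
    ((Category.comp_id _).trans pullback.condition)
  exact ⟨_, T, k, k', hk, hk'⟩

end ShortExtension

namespace NFoldExtension

lemma hasMorphism_pull : ∀ {n : ℕ} {A A' B : C} (E : NFoldExtension n A B) (a : A' ⟶ A),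
    HasMorphism a (𝟙 B) (E.pull a) E
  | 0, _, _, _, .short S, a => S.hasMorphism_pull a
  | _ + 1, _, _, _, .splice S E, a => ⟨𝟙 _, S.hasMorphism_pull a, Rel.refl E⟩

lemma hasMorphism_push : ∀ {n : ℕ} {A B B' : C} (E : NFoldExtension n A B) (b : B ⟶ B'),
    HasMorphism (𝟙 A) b E (E.push b)
  | 0, _, _, _, .short S, b => S.hasMorphism_push b
  | _ + 1, _, _, _, .splice _ E, b => ⟨𝟙 _, ⟨𝟙 _, by simp, by simp⟩, hasMorphism_push E b⟩

lemma hasMorphism_sum_fst : ∀ {n : ℕ} {A B A' B' : C} (E : NFoldExtension n A B)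
    (F : NFoldExtension n A' B'), HasMorphism biprod.fst biprod.fst (E.sum F) E
  | 0, _, _, _, _, .short S, .short S' =>
      ⟨biprod.fst, by simp [ShortExtension.sum], by simp [ShortExtension.sum]⟩
  | _ + 1, _, _, _, _, .splice S E, .splice S' E' =>
      ⟨biprod.fst, ⟨biprod.fst, by simp [ShortExtension.sum], by simp [ShortExtension.sum]⟩,
        hasMorphism_sum_fst E E'⟩

lemma hasMorphism_sum_snd : ∀ {n : ℕ} {A B A' B' : C} (E : NFoldExtension n A B)
    (F : NFoldExtension n A' B'), HasMorphism biprod.snd biprod.snd (E.sum F) F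
  | 0, _, _, _, _, .short S, .short S' =>
      ⟨biprod.snd, by simp [ShortExtension.sum], by simp [ShortExtension.sum]⟩
  | _ + 1, _, _, _, _, .splice S E, .splice S' E' =>
      ⟨biprod.snd, ⟨biprod.snd, by simp [ShortExtension.sum], by simp [ShortExtension.sum]⟩,
        hasMorphism_sum_snd E E'⟩

/-- An elementary relation in the tail extends by the identity of `S`, so splicing descends to
equivalence classes. -/
lemma quot_mk_splice_eq {n : ℕ} {A K B : C} (S : ShortExtension A K)
    {E E' : NFoldExtension n K B} (h : Quot.mk Rel E = Quot.mk Rel E') :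
    Quot.mk Rel (splice S E) = Quot.mk Rel (splice S E') :=
  congrArg (Quot.map (splice S) fun _ _ hE => ⟨𝟙 _, ⟨𝟙 _, by simp, by simp⟩, hE⟩) h

/-- Moves a morphism across the splice. Together with `quot_mk_splice_eq` this allows the first
short exact sequence to be replaced by any other one mapping to it over the identity of A. -/
lemma quot_mk_splice_pull {n : ℕ} {A K K' B : C} {S : ShortExtension A K}
    {S' : ShortExtension A K'} {k : K ⟶ K'} (h : ShortExtension.HasMorphism (𝟙 A) k S S')
    (E : NFoldExtension n K' B) :
    Quot.mk Rel (splice S (E.pull k)) = Quot.mk Rel (splice S' E) :=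
  Quot.sound ⟨k, h, E.hasMorphism_pull k⟩

end NFoldExtension

open Abelian

variable [HasExt.{w} C]

namespace ShortExtension

/-- The class in `Ext¹` of a short exact sequence. -/
noncomputable def extClass {A B : C} (S : ShortExtension A B) : Ext.{w} A B 1 :=
  S.exact.extClass

lemma HasMorphism.extClass_comp {A B A' B' : C} {a : A ⟶ A'} {b : B ⟶ B'}
    {S : ShortExtension A B} {S' : ShortExtension A' B'} (h : HasMorphism a b S S') :
    S.extClass.comp (Ext.mk₀.{w} b) (add_zero 1) =
      (Ext.mk₀ a).comp S'.extClass (zero_add 1) := by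
  obtain ⟨y, h₁, h₂⟩ := h
  exact ShortComplex.ShortExact.extClass_naturality S.exact S'.exact
    { τ₁ := b, τ₂ := y, τ₃ := a, comm₁₂ := h₁.symm, comm₂₃ := h₂.symm }

section LongExactSequences

variable {A B : C} (S : ShortExtension A B) {D : C}

lemma exists_mk₀_i_comp_eq {n p : ℕ} (x : Ext.{w} B D n) (hp : 1 + n = p)
    (h : S.extClass.comp x hp = 0) :
    ∃ y : Ext.{w} S.Y D n, (Ext.mk₀ S.i).comp y (zero_add n) = x :=
  Ext.contravariant_sequence_exact₁ S.exact D x hp h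

lemma exists_mk₀_p_comp_eq {n : ℕ} (x : Ext.{w} S.Y D n)
    (h : (Ext.mk₀ S.i).comp x (zero_add n) = 0) :
    ∃ y : Ext.{w} A D n, (Ext.mk₀ S.p).comp y (zero_add n) = x :=
  Ext.contravariant_sequence_exact₂ S.exact D x h

lemma exists_extClass_comp_eq {n p : ℕ} (x : Ext.{w} A D p) (hp : 1 + n = p)
    (h : (Ext.mk₀ S.p).comp x (zero_add p) = 0) :
    ∃ y : Ext.{w} B D n, S.extClass.comp y hp = x :=
  Ext.contravariant_sequence_exact₃ S.exact D x h hp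

lemma exists_comp_extClass_eq {n p : ℕ} (x : Ext.{w} D B p) (hp : n + 1 = p)
    (h : x.comp (Ext.mk₀ S.i) (add_zero p) = 0) :
    ∃ y : Ext.{w} D A n, y.comp S.extClass hp = x :=
  Ext.covariant_sequence_exact₁ D S.exact x h hp

lemma exists_comp_mk₀_i_eq {n : ℕ} (x : Ext.{w} D S.Y n)
    (h : x.comp (Ext.mk₀ S.p) (add_zero n) = 0) :
    ∃ y : Ext.{w} D B n, y.comp (Ext.mk₀ S.i) (add_zero n) = x :=
  Ext.covariant_sequence_exact₂ D S.exact x h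

lemma exists_comp_mk₀_p_eq {n p : ℕ} (x : Ext.{w} D A n) (hp : n + 1 = p)
    (h : x.comp S.extClass hp = 0) :
    ∃ y : Ext.{w} D S.Y n, y.comp (Ext.mk₀ S.p) (add_zero n) = x :=
  Ext.covariant_sequence_exact₃ D S.exact x hp h

lemma mk₀_p_comp_extClass : (Ext.mk₀.{w} S.p).comp S.extClass (zero_add 1) = 0 :=
  S.exact.comp_extClass

lemma extClass_comp_mk₀_i : S.extClass.comp (Ext.mk₀.{w} S.i) (add_zero 1) = 0 :=
  S.exact.extClass_comp

/-- Exactness at Hom(B, D) of the long exact sequence: the composite is the obstruction to extending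
f over the middle term. This and its dual turn vanishing in Ext back into morphisms. -/
lemma extClass_comp_mk₀_eq_zero_iff (f : B ⟶ D) :
    S.extClass.comp (Ext.mk₀.{w} f) (add_zero 1) = 0 ↔ ∃ g : S.Y ⟶ D, S.i ≫ g = f := by
  constructor
  · intro h
    obtain ⟨x, hx⟩ := S.exists_mk₀_i_comp_eq _ _ h
    obtain ⟨g, rfl⟩ := Ext.addEquiv₀.symm.surjective x
    refine ⟨g, (Ext.mk₀_bijective.{w} _ _).1 ?_⟩
    rw [← hx]
    exact (Ext.mk₀_comp_mk₀ _ _).symm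
  · rintro ⟨g, rfl⟩
    rw [← Ext.mk₀_comp_mk₀, ← Ext.comp_assoc_of_second_deg_zero, extClass_comp_mk₀_i,
      Ext.zero_comp]

lemma mk₀_comp_extClass_eq_zero_iff (f : D ⟶ A) :
    (Ext.mk₀.{w} f).comp S.extClass (zero_add 1) = 0 ↔ ∃ g : D ⟶ S.Y, g ≫ S.p = f := by
  constructor
  · intro h
    obtain ⟨x, hx⟩ := S.exists_comp_mk₀_p_eq _ _ h
    obtain ⟨g, rfl⟩ := Ext.addEquiv₀.symm.surjective x
    refine ⟨g, (Ext.mk₀_bijective.{w} _ _).1 ?_⟩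
    rw [← hx]
    exact (Ext.mk₀_comp_mk₀ _ _).symm
  · rintro ⟨g, rfl⟩
    rw [← Ext.mk₀_comp_mk₀_assoc, mk₀_p_comp_extClass, Ext.comp_zero]

end LongExactSequences

/-- Short exact sequences with equal classes are isomorphic. -/
lemma hasMorphism_of_extClass_eq {A B : C} {S S' : ShortExtension A B}
    (h : S.extClass = (S'.extClass : Ext.{w} A B 1)) : HasMorphism (𝟙 A) (𝟙 B) S S' := by
  -- The obstruction to lifting `S.p` through `S'.p` vanishes, since `S.p` kills the class of `S`.
  -- The lift y induces some b on B, not necessarily the identity.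
  have h₁ : (Ext.mk₀ S.p).comp S'.extClass (zero_add 1) = 0 :=
    h ▸ S.mk₀_p_comp_extClass
  obtain ⟨y, hy⟩ := (S'.mk₀_comp_extClass_eq_zero_iff S.p).1 h₁
  obtain ⟨b, hb, hm⟩ := exists_hasMorphism S S' (𝟙 A) y (by rw [hy, Category.comp_id])
  -- Hence b - 𝟙 extends to t on the middle term of `S`, and subtracting t ≫ `S'.i` from y corrects
  -- b to the identity.
  have h₂ : S.extClass.comp (Ext.mk₀ (b - 𝟙 B)) (add_zero 1) = 0 := by
    have := hm.extClass_comp.{w}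
    rw [sub_eq_add_neg, Ext.mk₀_add, Ext.comp_add, this, Ext.mk₀_neg, Ext.comp_neg,
      Ext.comp_mk₀_id, Ext.mk₀_id_comp, h, add_neg_cancel]
  obtain ⟨t, ht⟩ := (S.extClass_comp_mk₀_eq_zero_iff _).1 h₂
  refine ⟨y - t ≫ S'.i, ?_, ?_⟩
  · rw [Preadditive.comp_sub, hb, ← Category.assoc, ht, Preadditive.sub_comp, sub_sub_cancel]
  · rw [Category.comp_id, Preadditive.sub_comp, Category.assoc, S'.w, comp_zero, sub_zero, hy]

end ShortExtension

namespace NFoldExtension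

/-- The class in `Extⁿ⁺¹` of an exact `(n+1)`-fold sequence. -/
noncomputable def toExt : ∀ {n : ℕ} {A B : C}, NFoldExtension n A B → Ext.{w} A B (n + 1)
  | 0, _, _, .short S => S.extClass
  | _ + 1, _, _, .splice S E => S.extClass.comp E.toExt (add_comm _ _)

/-- Induction on length: the ladder component k at the splice slides from the tail to the head by
associativity of the Yoneda product. -/
lemma HasMorphism.toExt_comp : ∀ {n : ℕ} {A B A' B' : C} {a : A ⟶ A'} {b : B ⟶ B'}
    {E : NFoldExtension n A B} {E' : NFoldExtension n A' B'} (_ : HasMorphism a b E E'),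
    E.toExt.comp (Ext.mk₀.{w} b) (add_zero _) = (Ext.mk₀ a).comp E'.toExt (zero_add _)
  | 0, _, _, _, _, _, _, .short S, .short S', h => ShortExtension.HasMorphism.extClass_comp h
  | n + 1, _, _, _, _, a, b, .splice S E, .splice S' E', h => by
      obtain ⟨k, h₁, h₂⟩ := h
      change (S.extClass.comp E.toExt _).comp _ _ = (Ext.mk₀ a).comp (S'.extClass.comp E'.toExt _) _
      rw [Ext.comp_assoc_of_third_deg_zero, h₂.toExt_comp,
        ← Ext.comp_assoc S.extClass (Ext.mk₀ k) E'.toExt (add_zero 1) (zero_add _) (by lia),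
        h₁.extClass_comp, Ext.comp_assoc (Ext.mk₀ a) S'.extClass E'.toExt (zero_add 1) (add_comm _ _)
          (by lia)]

lemma Rel.toExt_eq {n : ℕ} {A B : C} {E E' : NFoldExtension n A B} (h : Rel E E') :
    E.toExt = (E'.toExt : Ext.{w} A B (n + 1)) := by
  simpa using HasMorphism.toExt_comp.{w} h

lemma toExt_pull {n : ℕ} {A A' B : C} (E : NFoldExtension n A B) (a : A' ⟶ A) :
    (E.pull a).toExt = (Ext.mk₀.{w} a).comp E.toExt (zero_add _) := by
  simpa using (E.hasMorphism_pull a).toExt_comp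

lemma toExt_push {n : ℕ} {A B B' : C} (E : NFoldExtension n A B) (b : B ⟶ B') :
    (E.push b).toExt = E.toExt.comp (Ext.mk₀.{w} b) (add_zero _) := by
  simpa using (E.hasMorphism_push b).toExt_comp.symm

/-- The codiagonal is the sum of the two projections. By biadditivity and the projections of `E.sum
F` onto its summands, each term restricts along the diagonal to one of the two classes. -/
lemma toExt_baerSum {n : ℕ} {A B : C} (E F : NFoldExtension n A B) :
    (E.baerSum F).toExt = (E.toExt + F.toExt : Ext.{w} A B (n + 1)) := by
  have hb : biprod.desc (𝟙 B) (𝟙 B) = biprod.fst + biprod.snd := by ext <;> simp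
  have h₁ := (hasMorphism_sum_fst E F).toExt_comp
  have h₂ := (hasMorphism_sum_snd E F).toExt_comp
  rw [baerSum, toExt_push, toExt_pull, hb, Ext.mk₀_add, Ext.comp_add,
    Ext.comp_assoc_of_third_deg_zero, Ext.comp_assoc_of_third_deg_zero, h₁, h₂,
    Ext.mk₀_comp_mk₀_assoc, Ext.mk₀_comp_mk₀_assoc, biprod.lift_fst, biprod.lift_snd,
    Ext.mk₀_id_comp, Ext.mk₀_id_comp]

/-- Dimension shifting by effaceability: a class killed by an epimorphism p factors through the
class of the short exact sequence of p, leaving a class on ker p of degree one less. -/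
lemma toExt_surjective : ∀ {n : ℕ} {A B : C} (e : Ext.{w} A B (n + 1)),
    ∃ E : NFoldExtension n A B, E.toExt = e
  | 0, A, B, e => by
      obtain ⟨P, p, _, hp⟩ := e.exists_epi_comp_eq_zero
      obtain ⟨x, hx⟩ := Ext.contravariant_sequence_exact₃ (ShortExtension.ofEpi p).exact B e hp
        (add_zero 1)
      obtain ⟨f, rfl⟩ := Ext.addEquiv₀.symm.surjective x
      exact ⟨(short (ShortExtension.ofEpi p)).push f, (toExt_push _ _).trans hx⟩
  | n + 1, A, B, e => by
      obtain ⟨P, p, _, hp⟩ := e.exists_epi_comp_eq_zero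
      obtain ⟨x, hx⟩ := Ext.contravariant_sequence_exact₃ (ShortExtension.ofEpi p).exact B e hp
        (add_comm 1 (n + 1))
      obtain ⟨E, rfl⟩ := toExt_surjective x
      exact ⟨.splice (ShortExtension.ofEpi p) E, hx⟩

/-- Exact sequences with equal classes are Yoneda equivalent. -/
lemma quot_mk_eq_of_toExt_eq : ∀ {n : ℕ} {A B : C} (E E' : NFoldExtension n A B),
    E.toExt = (E'.toExt : Ext.{w} A B (n + 1)) → Quot.mk Rel E = Quot.mk Rel E'
  | 0, _, _, .short S, .short S', h =>
      Quot.sound (ShortExtension.hasMorphism_of_extClass_eq h)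
  | n + 1, A, B, .splice S E, .splice S' E', h => by
      -- Both sequences are first rewritten with a common head `T`. Their tails may still differ in
      -- Ext, but only by a class killed by `T.extClass`.
      obtain ⟨K, T, k, k', hk, hk'⟩ := ShortExtension.exists_common_domination S S'
      have h₁ := quot_mk_splice_pull hk E
      have h₂ := quot_mk_splice_pull hk' E'
      rw [← h₁, ← h₂]
      have h₃ : T.extClass.comp ((E.pull k).toExt - (E'.pull k').toExt) (add_comm 1 (n + 1)) =
          (0 : Ext.{w} A B _) := by
        have e₁ : T.extClass.comp (E.pull k).toExt (add_comm 1 (n + 1)) = (splice S E).toExt :=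
          Rel.toExt_eq (E := splice T (E.pull k)) ⟨k, hk, E.hasMorphism_pull k⟩
        have e₂ : T.extClass.comp (E'.pull k').toExt (add_comm 1 (n + 1)) = (splice S' E').toExt :=
          Rel.toExt_eq (E := splice T (E'.pull k')) ⟨k', hk', E'.hasMorphism_pull k'⟩
        rw [sub_eq_add_neg, Ext.comp_add, Ext.comp_neg, e₁, e₂, h, add_neg_cancel]
      -- The difference of the tails is restricted from a class x on the middle term of `T`.
      -- Refining the head by an epimorphism q that kills x makes the tails equal in Ext, and
      -- induction applies to them.
      obtain ⟨x, hx⟩ := T.exists_mk₀_i_comp_eq _ _ h₃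
      obtain ⟨P, q, _, hq⟩ := x.exists_epi_comp_eq_zero
      have : Epi T.p := T.exact.epi_g
      have : Epi (q ≫ T.p) := epi_comp _ _
      obtain ⟨l, hl, hm⟩ := ShortExtension.exists_hasMorphism
        (ShortExtension.ofEpi (q ≫ T.p)) T (𝟙 A) q (Category.comp_id _)
      have h₄ : ((E.pull k).pull l).toExt = (((E'.pull k').pull l).toExt : Ext.{w} _ B _) := by
        rw [toExt_pull _ l, toExt_pull _ l, ← sub_eq_zero, sub_eq_add_neg, ← Ext.comp_neg,
          ← Ext.comp_add, ← sub_eq_add_neg, ← hx, Ext.mk₀_comp_mk₀_assoc]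
        rw [show l ≫ T.i = kernel.ι (q ≫ T.p) ≫ q from hl.symm,
          ← Ext.mk₀_comp_mk₀_assoc, hq, Ext.comp_zero]
      rw [← quot_mk_splice_pull hm, ← quot_mk_splice_pull hm]
      exact quot_mk_splice_eq _ (quot_mk_eq_of_toExt_eq _ _ h₄)

end NFoldExtension

namespace YonedaExt

/-- Yoneda `Ext` is isomorphic to `Ext` computed in the derived category. -/
noncomputable def extEquiv (n : ℕ) (A B : C) : YonedaExt (n + 1) A B ≃+ Ext.{w} A B (n + 1) where
  toEquiv := Equiv.ofBijective
    (Quot.lift (NFoldExtension.toExt (n := n)) fun _ _ h => h.toExt_eq) (by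
      refine ⟨?_, fun e => ?_⟩
      · rintro ⟨E⟩ ⟨E'⟩ h
        exact NFoldExtension.quot_mk_eq_of_toExt_eq E E' h
      · obtain ⟨E, rfl⟩ := NFoldExtension.toExt_surjective e
        exact ⟨Quot.mk _ E, rfl⟩)
  map_add' := by
    rintro ⟨E⟩ ⟨E'⟩
    exact NFoldExtension.toExt_baerSum E E'

lemma extEquiv_map (n : ℕ) {A A' B B' : C} (a : A' ⟶ A) (b : B ⟶ B') (x : YonedaExt (n + 1) A B) :
    extEquiv.{w} n A' B' (map a b x) = Ext.bimap a b (n + 1) (extEquiv n A B x) := by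
  obtain ⟨E⟩ := x
  refine (NFoldExtension.toExt_push _ _).trans ?_
  rw [NFoldExtension.toExt_pull, Ext.comp_assoc_of_third_deg_zero]
  rfl

lemma subsingleton_iff (n : ℕ) (A B : C) :
    Subsingleton (YonedaExt (n + 1) A B) ↔ Subsingleton (Ext.{w} A B (n + 1)) :=
  (extEquiv.{w} n A B).toEquiv.subsingleton_congr

end YonedaExt

end

/-! ### Dimension shifting along splices with Ext-acyclic middle terms -/

section

variable {C : Type u₁} [Category.{v₁} C] [Abelian C]

open Abelian

section

variable [HasExt.{w} C]

namespace ShortExtension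

section Resolution

variable {Z : ℕ → C} (S : ∀ k, ShortExtension (Z k) (Z (k + 1)))

/-- The class in `Extⁿ` of the splice of the first `n` short exact sequences `S 0`, `S 1`, …. -/
noncomputable def leftSpliceClass : ∀ n : ℕ, Ext.{w} (Z 0) (Z n) n
  | 0 => Ext.mk₀ (𝟙 _)
  | n + 1 => (leftSpliceClass n).comp (S n).extClass rfl

lemma leftSpliceClass_succ (n : ℕ) :
    leftSpliceClass.{w} S (n + 1) = (leftSpliceClass S n).comp (S n).extClass rfl := rfl

lemma leftSpliceClass_naturality {Z' : ℕ → C} (S' : ∀ k, ShortExtension (Z' k) (Z' (k + 1)))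
    (f : ∀ k, Z k ⟶ Z' k) (hf : ∀ k, HasMorphism (f k) (f (k + 1)) (S k) (S' k)) (n : ℕ) :
    (leftSpliceClass.{w} S n).comp (Ext.mk₀ (f n)) (add_zero n) =
      (Ext.mk₀ (f 0)).comp (leftSpliceClass S' n) (zero_add n) := by
  induction n with
  | zero => simp [leftSpliceClass]
  | succ n ih =>
    rw [leftSpliceClass_succ, leftSpliceClass_succ, Ext.comp_assoc_of_third_deg_zero,
      (hf n).extClass_comp, ← Ext.comp_assoc_of_second_deg_zero, ih,
      Ext.comp_assoc (Ext.mk₀ (f 0)) _ _ (zero_add n) rfl (by lia)]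

variable {S} {D : C} (hS : ∀ k m : ℕ, Subsingleton (Ext.{w} (S k).Y D (m + 1)))

include hS

/-- The connecting map lies between the Ext groups of the middle term in degrees m + 1 and m + 2.
Both vanish, as the source has positive degree. -/
lemma extClass_precomp_bijective (k m : ℕ) {p : ℕ} (hp : 1 + (m + 1) = p) :
    Function.Bijective fun x : Ext.{w} (Z (k + 1)) D (m + 1) => (S k).extClass.comp x hp := by
  constructor
  · intro x y h
    have h' : (S k).extClass.comp (x - y) hp = 0 := by
      rw [sub_eq_add_neg, Ext.comp_add, Ext.comp_neg, add_neg_eq_zero]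
      exact h
    obtain ⟨z, hz⟩ := (S k).exists_mk₀_i_comp_eq _ hp h'
    have := hS k m
    rw [← sub_eq_zero, ← hz, Subsingleton.elim z 0, Ext.comp_zero]
  · intro y
    obtain rfl : (m + 1) + 1 = p := by lia
    have := hS k (m + 1)
    exact (S k).exists_extClass_comp_eq y hp (Subsingleton.elim _ _)

lemma leftSpliceClass_precomp_bijective (n m : ℕ) {p : ℕ} (hp : n + (m + 1) = p) :
    Function.Bijective fun x : Ext.{w} (Z n) D (m + 1) => (leftSpliceClass S n).comp x hp := by
  induction n generalizing m with
  | zero =>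
    obtain rfl : m + 1 = p := by lia
    simpa [leftSpliceClass] using! Function.bijective_id
  | succ n ih =>
    convert (ih (m + 1) (by lia)).comp (extClass_precomp_bijective hS n m (by lia)) using 1
    ext x
    exact Ext.comp_assoc _ _ _ _ _ (by lia)

/-- The last shift, from Hom to Ext¹, is only surjective, because Hom from the middle term need not
vanish. Its kernel, found in the next lemma, becomes the coboundaries. -/
lemma leftSpliceClass_comp_mk₀_surjective (n : ℕ) (y : Ext.{w} (Z 0) D (n + 1)) :
    ∃ f : Z (n + 1) ⟶ D, (leftSpliceClass S (n + 1)).comp (Ext.mk₀ f) (add_zero _) = y := by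
  obtain ⟨x, rfl⟩ := (leftSpliceClass_precomp_bijective hS n 0 rfl).2 y
  have := hS n 0
  obtain ⟨z, rfl⟩ := (S n).exists_extClass_comp_eq x (add_zero 1) (Subsingleton.elim _ _)
  obtain ⟨f, rfl⟩ := Ext.addEquiv₀.symm.surjective z
  exact ⟨f, Ext.comp_assoc_of_third_deg_zero _ _ _ _⟩

lemma leftSpliceClass_comp_mk₀_eq_zero_iff (n : ℕ) (f : Z (n + 1) ⟶ D) :
    (leftSpliceClass.{w} S (n + 1)).comp (Ext.mk₀ f) (add_zero _) = 0 ↔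
      ∃ g : (S n).Y ⟶ D, (S n).i ≫ g = f := by
  rw [leftSpliceClass_succ, Ext.comp_assoc_of_third_deg_zero, ← extClass_comp_mk₀_eq_zero_iff.{w}]
  refine ⟨fun h => ?_, fun h => by rw [h, Ext.comp_zero]⟩
  refine (leftSpliceClass_precomp_bijective hS n 0 rfl).1 (h.trans ?_)
  exact (Ext.comp_zero _ _ _ _ _).symm

end Resolution

/-! ### The dual dimension shifting, in the second variable -/

section Coresolution

variable {Z : ℕ → C} (S : ∀ k, ShortExtension (Z (k + 1)) (Z k))

/-- The class in `Extⁿ` of the splice of the first `n` short exact sequences `S 0`, `S 1`, …. -/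
noncomputable def rightSpliceClass : ∀ n : ℕ, Ext.{w} (Z n) (Z 0) n
  | 0 => Ext.mk₀ (𝟙 _)
  | n + 1 => (S n).extClass.comp (rightSpliceClass n) (add_comm 1 n)

lemma rightSpliceClass_succ (n : ℕ) :
    rightSpliceClass.{w} S (n + 1) =
      (S n).extClass.comp (rightSpliceClass S n) (add_comm 1 n) := rfl

lemma rightSpliceClass_naturality {Z' : ℕ → C} (S' : ∀ k, ShortExtension (Z' (k + 1)) (Z' k))
    (f : ∀ k, Z k ⟶ Z' k) (hf : ∀ k, HasMorphism (f (k + 1)) (f k) (S k) (S' k)) (n : ℕ) :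
    (rightSpliceClass.{w} S n).comp (Ext.mk₀ (f 0)) (add_zero n) =
      (Ext.mk₀ (f n)).comp (rightSpliceClass S' n) (zero_add n) := by
  induction n with
  | zero => simp [rightSpliceClass]
  | succ n ih =>
    rw [rightSpliceClass_succ, rightSpliceClass_succ, Ext.comp_assoc_of_third_deg_zero, ih,
      ← Ext.comp_assoc_of_second_deg_zero, (hf n).extClass_comp,
      Ext.comp_assoc (Ext.mk₀ (f (n + 1))) _ _ (zero_add 1) (add_comm 1 n) (by lia)]

variable {S} {D : C} (hS : ∀ k m : ℕ, Subsingleton (Ext.{w} D (S k).Y (m + 1)))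

include hS

lemma extClass_postcomp_bijective (k m : ℕ) {p : ℕ} (hp : m + 1 + 1 = p) :
    Function.Bijective fun x : Ext.{w} D (Z (k + 1)) (m + 1) => x.comp (S k).extClass hp := by
  constructor
  · intro x y h
    have h' : (x - y).comp (S k).extClass hp = 0 := by
      rw [sub_eq_add_neg, Ext.add_comp, Ext.neg_comp, add_neg_eq_zero]
      exact h
    obtain ⟨z, hz⟩ := (S k).exists_comp_mk₀_p_eq _ hp h'
    have := hS k m
    rw [← sub_eq_zero, ← hz, Subsingleton.elim z 0, Ext.zero_comp]
  · intro y
    subst hp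
    have := hS k (m + 1)
    exact (S k).exists_comp_extClass_eq y rfl (Subsingleton.elim _ _)

lemma rightSpliceClass_postcomp_bijective (n m : ℕ) {p : ℕ} (hp : m + 1 + n = p) :
    Function.Bijective fun x : Ext.{w} D (Z n) (m + 1) => x.comp (rightSpliceClass S n) hp := by
  induction n generalizing m with
  | zero =>
    obtain rfl : m + 1 = p := by lia
    simpa [rightSpliceClass] using! Function.bijective_id
  | succ n ih =>
    convert (ih (m + 1) (by lia)).comp (extClass_postcomp_bijective hS n m rfl) using 1
    ext x
    exact (Ext.comp_assoc _ _ _ _ _ (by lia)).symm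

lemma mk₀_comp_rightSpliceClass_surjective (n : ℕ) (y : Ext.{w} D (Z 0) (n + 1)) :
    ∃ f : D ⟶ Z (n + 1), (Ext.mk₀ f).comp (rightSpliceClass S (n + 1)) (zero_add _) = y := by
  obtain ⟨x, rfl⟩ := (rightSpliceClass_postcomp_bijective hS n 0 (by lia)).2 y
  have := hS n 0
  obtain ⟨z, rfl⟩ := (S n).exists_comp_extClass_eq x (zero_add 1) (Subsingleton.elim _ _)
  obtain ⟨f, rfl⟩ := Ext.addEquiv₀.symm.surjective z
  exact ⟨f, (Ext.comp_assoc (Ext.mk₀ f) (S n).extClass (rightSpliceClass S n)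
    (zero_add 1) (add_comm 1 n) (by lia)).symm⟩

lemma mk₀_comp_rightSpliceClass_eq_zero_iff (n : ℕ) (f : D ⟶ Z (n + 1)) :
    (Ext.mk₀ f).comp (rightSpliceClass.{w} S (n + 1)) (zero_add _) = 0 ↔
      ∃ g : D ⟶ (S n).Y, g ≫ (S n).p = f := by
  rw [rightSpliceClass_succ, ← Ext.comp_assoc (Ext.mk₀ f) (S n).extClass (rightSpliceClass S n)
    (zero_add 1) (add_comm 1 n) (by lia), ← mk₀_comp_extClass_eq_zero_iff.{w}]
  refine ⟨fun h => ?_, fun h => by rw [h, Ext.zero_comp]⟩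
  refine (rightSpliceClass_postcomp_bijective hS n 0 (by lia)).1 (h.trans ?_)
  exact (Ext.zero_comp _ _ _ _ _).symm

end Coresolution

end ShortExtension

end

end

/-! ### Hom complexes of exact complexes and Ext -/

section

variable {C : Type u₁} [Category.{v₁} C] [Abelian C]

open Abelian

section Chain

variable {K K' : ChainComplex C ℤ}

open HomologicalComplex

/-- The short exact sequence `0 ⟶ K_{k+1} / B_{k+1} ⟶ K_k ⟶ K_k / B_k ⟶ 0` of an exact complex. -/
noncomputable def opcyclesExtension (hK : ∀ i, K.ExactAt i) (k : ℕ) :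
    ShortExtension (K.opcycles (k : ℤ)) (K.opcycles ((k + 1 : ℕ) : ℤ)) where
  Y := K.X k
  i := K.fromOpcycles _ _
  p := K.pOpcycles _
  w := by rw [← cancel_epi (K.pOpcycles _), p_fromOpcycles_assoc, d_pOpcycles, comp_zero]
  exact := by
    have h : (ComplexShape.down ℤ).next ((k + 1 : ℕ) : ℤ) = (k : ℤ) :=
      (ComplexShape.down ℤ).next_eq' (by simp)
    have : Mono (K.fromOpcycles ((k + 1 : ℕ) : ℤ) (k : ℤ)) := by
      rw [← h]
      exact (hK _).mono_fromOpcycles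
    refine ShortComplex.ShortExact.mk' ?_ this inferInstance
    refine ShortComplex.exact_of_g_is_cokernel _ (CokernelCofork.IsColimit.ofπ' _ _ fun f hf =>
      ⟨K.descOpcycles f ((k + 1 : ℕ) : ℤ) ((ComplexShape.down ℤ).prev_eq' (by simp)) ?_,
        K.p_descOpcycles _ _ _ _⟩)
    rw [← p_fromOpcycles, Category.assoc]
    exact (congrArg _ hf).trans comp_zero

lemma opcyclesExtension_hasMorphism (hK : ∀ i, K.ExactAt i) (hK' : ∀ i, K'.ExactAt i)
    (α : K ⟶ K') (k : ℕ) :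
    ShortExtension.HasMorphism (opcyclesMap α _) (opcyclesMap α _)
      (opcyclesExtension hK k) (opcyclesExtension hK' k) := by
  refine ⟨α.f k, ?_, p_opcyclesMap α _⟩
  change K.fromOpcycles _ _ ≫ α.f k = opcyclesMap α _ ≫ K'.fromOpcycles _ _
  rw [← cancel_epi (K.pOpcycles _), p_fromOpcycles_assoc, p_opcyclesMap_assoc, p_fromOpcycles,
    α.comm]

/-- Cocycles of `Hom(K, B)` are the morphisms from the opcycles of `K`. -/
noncomputable def leftCocyclesEquiv (n : ℤ) (K : ChainComplex C ℤ) (B : C) :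
    leftCocycles n K B ≃+ (K.opcycles n ⟶ B) :=
  AddEquiv.symm
  { toFun g := ⟨K.pOpcycles n ≫ g, show K.d (n + 1) n ≫ K.pOpcycles n ≫ g = 0 by
      rw [d_pOpcycles_assoc, zero_comp]⟩
    invFun f := K.descOpcycles f.1 (n + 1) ((ComplexShape.down ℤ).prev_eq' (by simp)) f.2
    left_inv g := (cancel_epi (K.pOpcycles n)).1 (K.p_descOpcycles _ _ _ _)
    right_inv f := Subtype.ext (K.p_descOpcycles _ _ _ _)
    map_add' f g := Subtype.ext (Preadditive.comp_add _ _ _ _ _ _) }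

@[simp]
lemma pOpcycles_comp_leftCocyclesEquiv {n : ℤ} {B : C} (f : leftCocycles n K B) :
    K.pOpcycles n ≫ leftCocyclesEquiv n K B f = f.1 :=
  K.p_descOpcycles f.1 (n + 1) ((ComplexShape.down ℤ).prev_eq' (by simp)) f.2

lemma leftCocyclesEquiv_map {n : ℤ} {B B' : C} (α : K' ⟶ K) (b : B ⟶ B')
    (f : leftCocycles n K B) :
    leftCocyclesEquiv n K' B' (leftCocyclesMap n α b f) =
      opcyclesMap α n ≫ leftCocyclesEquiv n K B f ≫ b := by
  rw [← cancel_epi (K'.pOpcycles n), pOpcycles_comp_leftCocyclesEquiv, p_opcyclesMap_assoc,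
    ← Category.assoc (K.pOpcycles n), pOpcycles_comp_leftCocyclesEquiv]
  rfl

/-- With m free, the degree (n + 1) - 1 can be read as n without transporting morphisms along an
equality of degrees. -/
lemma mem_leftCoboundaries_iff {n m : ℤ} (h : n - 1 = m) {B : C} (f : K.X n ⟶ B) :
    f ∈ leftCoboundaries n K B ↔ ∃ g : K.X m ⟶ B, K.d n m ≫ g = f := by
  subst h
  rfl

variable [HasExt.{w} C]

/-- The homomorphism `Zⁿ Hom(K, B) → Extⁿ(K₀ / B₀, B)` defined by splicing. -/
noncomputable def leftCocyclesToExt (hK : ∀ i, K.ExactAt i) (n : ℕ) (B : C) :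
    leftCocycles (n : ℤ) K B →+ Ext.{w} (K.opcycles ((0 : ℕ) : ℤ)) B n where
  toFun f := (ShortExtension.leftSpliceClass (opcyclesExtension hK) n).comp
    (Ext.mk₀ (leftCocyclesEquiv n K B f)) (add_zero n)
  map_zero' := by simp
  map_add' f g := by rw [map_add, Ext.mk₀_add, Ext.comp_add]

lemma leftCocyclesToExt_apply (hK : ∀ i, K.ExactAt i) {n : ℕ} {B : C}
    (f : leftCocycles (n : ℤ) K B) :
    leftCocyclesToExt.{w} hK n B f =
      (ShortExtension.leftSpliceClass (opcyclesExtension hK) n).comp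
        (Ext.mk₀ (leftCocyclesEquiv n K B f)) (add_zero n) := rfl

/-- If the terms of an exact complex `K` in nonnegative degrees have no higher `Ext` into `B`, then
the cohomology of `Hom(K, B)` in positive degrees computes `Ext(K₀ / B₀, B)`. -/
noncomputable def leftHomCohomologyEquiv (hK : ∀ i, K.ExactAt i) {B : C}
    (hB : ∀ k m : ℕ, Subsingleton (Ext.{w} (K.X k) B (m + 1))) (n : ℕ) :
    LeftHomCohomology ((n + 1 : ℕ) : ℤ) K B ≃+
      Ext.{w} (K.opcycles ((0 : ℕ) : ℤ)) B (n + 1) :=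
  QuotientAddGroup.liftEquiv _ (φ := leftCocyclesToExt hK (n + 1) B)
    (fun y => by
      obtain ⟨f, rfl⟩ := ShortExtension.leftSpliceClass_comp_mk₀_surjective
        (S := opcyclesExtension hK) hB n y
      obtain ⟨f, rfl⟩ := (leftCocyclesEquiv _ K B).surjective f
      exact ⟨f, rfl⟩)
    (by
      ext f
      rw [AddSubgroup.mem_addSubgroupOf, mem_leftCoboundaries_iff (m := (n : ℤ)) (by simp),
        AddMonoidHom.mem_ker, leftCocyclesToExt_apply]
      -- The splice class kills exactly the maps that extend over K_n along K_{n+1}/B_{n+1} ⟶ K_n.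
      -- After precomposition with the projection from K_{n+1} this is the coboundary condition.
      refine Iff.trans ?_ (ShortExtension.leftSpliceClass_comp_mk₀_eq_zero_iff
        (S := opcyclesExtension hK) hB n _).symm
      refine exists_congr fun g => ?_
      rw [← cancel_epi (K.pOpcycles _), pOpcycles_comp_leftCocyclesEquiv]
      change _ ↔ K.pOpcycles _ ≫ K.fromOpcycles _ _ ≫ g = _
      rw [p_fromOpcycles_assoc])

lemma leftHomCohomologyEquiv_map (hK : ∀ i, K.ExactAt i) (hK' : ∀ i, K'.ExactAt i) {B B' : C}
    (hB : ∀ k m : ℕ, Subsingleton (Ext.{w} (K.X k) B (m + 1)))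
    (hB' : ∀ k m : ℕ, Subsingleton (Ext.{w} (K'.X k) B' (m + 1))) (n : ℕ)
    (α : K' ⟶ K) (b : B ⟶ B') (x : LeftHomCohomology ((n + 1 : ℕ) : ℤ) K B) :
    leftHomCohomologyEquiv hK' hB' n (LeftHomCohomology.map _ α b x) =
      (Ext.mk₀ (opcyclesMap α _)).comp
        ((leftHomCohomologyEquiv hK hB n x).comp (Ext.mk₀ b) (add_zero _)) (zero_add _) := by
  obtain ⟨f, rfl⟩ := QuotientAddGroup.mk_surjective x
  change leftCocyclesToExt hK' (n + 1) B' (leftCocyclesMap _ α b f) =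
    (Ext.mk₀ _).comp ((leftCocyclesToExt hK (n + 1) B f).comp _ _) _
  rw [leftCocyclesToExt_apply, leftCocyclesToExt_apply, leftCocyclesEquiv_map,
    ← Ext.mk₀_comp_mk₀, ← Ext.mk₀_comp_mk₀, ← Ext.comp_assoc_of_third_deg_zero,
    ShortExtension.leftSpliceClass_naturality _ (opcyclesExtension hK) (fun k => opcyclesMap α _)
      (opcyclesExtension_hasMorphism hK' hK α), Ext.comp_assoc_of_third_deg_zero,
    Ext.comp_assoc_of_third_deg_zero]

end Chain

/-! ### The dual computation, with cycles in place of opcycles -/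

section Cochain

variable {K K' : CochainComplex C ℤ}

open HomologicalComplex

/-- The short exact sequence `0 ⟶ Z^k ⟶ K^k ⟶ Z^{k+1} ⟶ 0` of an exact complex. -/
noncomputable def cyclesExtension (hK : ∀ i, K.ExactAt i) (k : ℕ) :
    ShortExtension (K.cycles ((k + 1 : ℕ) : ℤ)) (K.cycles (k : ℤ)) where
  Y := K.X k
  i := K.iCycles _
  p := K.toCycles _ _
  w := by rw [← cancel_mono (K.iCycles _), Category.assoc, toCycles_i, iCycles_d, zero_comp]
  exact := by
    have h : (ComplexShape.up ℤ).prev ((k + 1 : ℕ) : ℤ) = (k : ℤ) :=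
      (ComplexShape.up ℤ).prev_eq' (by simp)
    have : Epi (K.toCycles (k : ℤ) ((k + 1 : ℕ) : ℤ)) := by
      rw [← h]
      exact (hK _).epi_toCycles
    refine ShortComplex.ShortExact.mk' ?_ inferInstance this
    refine ShortComplex.exact_of_f_is_kernel _ (KernelFork.IsLimit.ofι' _ _ fun f hf =>
      ⟨K.liftCycles f ((k + 1 : ℕ) : ℤ) ((ComplexShape.up ℤ).next_eq' (by simp)) ?_,
        K.liftCycles_i _ _ _ _⟩)
    rw [← toCycles_i, ← Category.assoc]
    exact (congrArg (· ≫ _) hf).trans zero_comp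

lemma cyclesExtension_hasMorphism (hK : ∀ i, K.ExactAt i) (hK' : ∀ i, K'.ExactAt i)
    (α : K ⟶ K') (k : ℕ) :
    ShortExtension.HasMorphism (cyclesMap α _) (cyclesMap α _)
      (cyclesExtension hK k) (cyclesExtension hK' k) := by
  refine ⟨α.f k, (cyclesMap_i α _).symm, ?_⟩
  change K.toCycles _ _ ≫ cyclesMap α _ = α.f k ≫ K'.toCycles _ _
  rw [← cancel_mono (K'.iCycles _), Category.assoc, Category.assoc, toCycles_i, cyclesMap_i,
    toCycles_i_assoc, α.comm]

/-- Cocycles of `Hom(A, K)` are the morphisms to the cycles of `K`. -/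
noncomputable def rightCocyclesEquiv (n : ℤ) (A : C) (K : CochainComplex C ℤ) :
    rightCocycles n A K ≃+ (A ⟶ K.cycles n) :=
  AddEquiv.symm
  { toFun g := ⟨g ≫ K.iCycles n, show (g ≫ K.iCycles n) ≫ K.d n (n + 1) = 0 by
      rw [Category.assoc, iCycles_d, comp_zero]⟩
    invFun f := K.liftCycles f.1 (n + 1) ((ComplexShape.up ℤ).next_eq' (by simp)) f.2
    left_inv g := (cancel_mono (K.iCycles n)).1 (K.liftCycles_i _ _ _ _)
    right_inv f := Subtype.ext (K.liftCycles_i _ _ _ _)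
    map_add' f g := Subtype.ext (Preadditive.add_comp _ _ _ _ _ _) }

@[simp]
lemma rightCocyclesEquiv_comp_iCycles {n : ℤ} {A : C} (f : rightCocycles n A K) :
    rightCocyclesEquiv n A K f ≫ K.iCycles n = f.1 :=
  K.liftCycles_i f.1 (n + 1) ((ComplexShape.up ℤ).next_eq' (by simp)) f.2

lemma rightCocyclesEquiv_map {n : ℤ} {A A' : C} (a : A' ⟶ A) (β : K ⟶ K')
    (f : rightCocycles n A K) :
    rightCocyclesEquiv n A' K' (rightCocyclesMap n a β f) =
      a ≫ rightCocyclesEquiv n A K f ≫ cyclesMap β n := by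
  rw [← cancel_mono (K'.iCycles n), rightCocyclesEquiv_comp_iCycles, Category.assoc,
    Category.assoc, cyclesMap_i, ← Category.assoc (rightCocyclesEquiv n A K f),
    rightCocyclesEquiv_comp_iCycles]
  rfl

lemma mem_rightCoboundaries_iff {n m : ℤ} (h : n - 1 = m) {A : C} (f : A ⟶ K.X n) :
    f ∈ rightCoboundaries n A K ↔ ∃ g : A ⟶ K.X m, g ≫ K.d m n = f := by
  subst h
  rfl

variable [HasExt.{w} C]

/-- The homomorphism `Zⁿ Hom(A, K) → Extⁿ(A, Z⁰)` defined by splicing. -/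
noncomputable def rightCocyclesToExt (hK : ∀ i, K.ExactAt i) (n : ℕ) (A : C) :
    rightCocycles (n : ℤ) A K →+ Ext.{w} A (K.cycles ((0 : ℕ) : ℤ)) n where
  toFun f := (Ext.mk₀ (rightCocyclesEquiv n A K f)).comp
    (ShortExtension.rightSpliceClass (Z := fun k : ℕ => K.cycles (k : ℤ))
      (cyclesExtension hK) n) (zero_add n)
  map_zero' := by simp
  map_add' f g := by rw [map_add, Ext.mk₀_add, Ext.add_comp]

lemma rightCocyclesToExt_apply (hK : ∀ i, K.ExactAt i) {n : ℕ} {A : C}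
    (f : rightCocycles (n : ℤ) A K) :
    rightCocyclesToExt.{w} hK n A f =
      (Ext.mk₀ (rightCocyclesEquiv n A K f)).comp
        (ShortExtension.rightSpliceClass (Z := fun k : ℕ => K.cycles (k : ℤ))
      (cyclesExtension hK) n) (zero_add n) := rfl

/-- If the terms of an exact complex `K` in nonnegative degrees have no higher `Ext` from `A`, then
the cohomology of `Hom(A, K)` in positive degrees computes `Ext(A, Z⁰)`. -/
noncomputable def rightHomCohomologyEquiv (hK : ∀ i, K.ExactAt i) {A : C}
    (hA : ∀ k m : ℕ, Subsingleton (Ext.{w} A (K.X k) (m + 1))) (n : ℕ) :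
    RightHomCohomology ((n + 1 : ℕ) : ℤ) A K ≃+
      Ext.{w} A (K.cycles ((0 : ℕ) : ℤ)) (n + 1) :=
  QuotientAddGroup.liftEquiv _ (φ := rightCocyclesToExt hK (n + 1) A)
    (fun y => by
      obtain ⟨f, rfl⟩ := ShortExtension.mk₀_comp_rightSpliceClass_surjective
        (Z := fun k : ℕ => K.cycles (k : ℤ)) (S := cyclesExtension hK) hA n y
      obtain ⟨f, rfl⟩ := (rightCocyclesEquiv _ A K).surjective f
      exact ⟨f, rfl⟩)
    (by
      ext f
      rw [AddSubgroup.mem_addSubgroupOf, mem_rightCoboundaries_iff (m := (n : ℤ)) (by simp),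
        AddMonoidHom.mem_ker, rightCocyclesToExt_apply]
      refine Iff.trans ?_ (ShortExtension.mk₀_comp_rightSpliceClass_eq_zero_iff
        (Z := fun k : ℕ => K.cycles (k : ℤ)) (S := cyclesExtension hK) hA n _).symm
      refine exists_congr fun g => ?_
      rw [← cancel_mono (K.iCycles _), rightCocyclesEquiv_comp_iCycles]
      change _ ↔ (g ≫ K.toCycles _ _) ≫ K.iCycles _ = _
      rw [Category.assoc, toCycles_i])

lemma rightHomCohomologyEquiv_map (hK : ∀ i, K.ExactAt i) (hK' : ∀ i, K'.ExactAt i) {A A' : C}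
    (hA : ∀ k m : ℕ, Subsingleton (Ext.{w} A (K.X k) (m + 1)))
    (hA' : ∀ k m : ℕ, Subsingleton (Ext.{w} A' (K'.X k) (m + 1))) (n : ℕ)
    (a : A' ⟶ A) (β : K ⟶ K') (x : RightHomCohomology ((n + 1 : ℕ) : ℤ) A K) :
    rightHomCohomologyEquiv hK' hA' n (RightHomCohomology.map _ a β x) =
      (Ext.mk₀ a).comp ((rightHomCohomologyEquiv hK hA n x).comp
        (Ext.mk₀ (cyclesMap β _)) (add_zero _)) (zero_add _) := by
  obtain ⟨f, rfl⟩ := QuotientAddGroup.mk_surjective x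
  change rightCocyclesToExt hK' (n + 1) A' (rightCocyclesMap _ a β f) =
    (Ext.mk₀ _).comp ((rightCocyclesToExt hK (n + 1) A f).comp _ _) _
  rw [rightCocyclesToExt_apply, rightCocyclesToExt_apply, rightCocyclesEquiv_map,
    Ext.comp_assoc_of_third_deg_zero,
    ShortExtension.rightSpliceClass_naturality (Z := fun k : ℕ => K.cycles (k : ℤ))
      (Z' := fun k : ℕ => K'.cycles (k : ℤ)) _ (cyclesExtension hK') (fun k => cyclesMap β _)
      (cyclesExtension_hasMorphism hK hK' β), Ext.mk₀_comp_mk₀_assoc, Ext.mk₀_comp_mk₀_assoc]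
  simp only [Category.assoc]

end Cochain

/-! ### Recovering the resolved object from an 𝔐-(co)resolution -/

namespace AbelianModelStructure

variable {M : AbelianModelStructure C} {A B : C}

open HomologicalComplex

/-- The canonical morphism from `W₀ / B₀` to the object resolved by `W`. -/
noncomputable def Resolution.fromOpcycles (W : M.Resolution A) :
    W.complex.opcycles ((0 : ℕ) : ℤ) ⟶ A :=
  W.complex.descOpcycles W.ε 1 ((ComplexShape.down ℤ).prev_eq' (by simp)) (by
    -- ε kills boundaries because η is a monomorphism and ε ≫ η is a differential.
    have := W.mono
    rw [← cancel_mono W.η, Category.assoc, zero_comp]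
    exact (congrArg _ W.fac.symm).trans (W.complex.d_comp_d _ _ _))

lemma Resolution.p_fromOpcycles (W : M.Resolution A) :
    W.complex.pOpcycles ((0 : ℕ) : ℤ) ≫ W.fromOpcycles = W.ε :=
  W.complex.p_descOpcycles _ _ _ _

/-- It is epi because ε is. It is mono because, by exactness in degree 0, W_0/B_0 embeds in W_{-1},
and this embedding factors through it. -/
instance (W : M.Resolution A) : IsIso W.fromOpcycles := by
  have := W.epi
  have : Epi W.fromOpcycles := epi_of_epi_fac W.p_fromOpcycles
  have h : (ComplexShape.down ℤ).next ((0 : ℕ) : ℤ) = -1 :=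
    (ComplexShape.down ℤ).next_eq' (by simp)
  have hm : Mono (W.complex.fromOpcycles ((0 : ℕ) : ℤ) (-1)) := by
    rw [← h]
    exact (W.exact _).mono_fromOpcycles
  have hf : W.fromOpcycles ≫ W.η = W.complex.fromOpcycles _ _ := by
    rw [← cancel_epi (W.complex.pOpcycles _), reassoc_of% W.p_fromOpcycles,
      HomologicalComplex.p_fromOpcycles]
    exact W.fac.symm
  have : Mono (W.fromOpcycles ≫ W.η) := hf ▸ hm
  have : Mono W.fromOpcycles := mono_of_mono _ W.η
  exact isIso_of_mono_of_epi _

lemma Resolution.Extends.opcyclesMap_comp {W : M.Resolution A} {W' : M.Resolution B} {f : A ⟶ B}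
    {α : W.complex ⟶ W'.complex} (h : W.Extends W' f α) :
    opcyclesMap α _ ≫ W'.fromOpcycles = W.fromOpcycles ≫ f := by
  rw [← cancel_epi (W.complex.pOpcycles _), p_opcyclesMap_assoc, W'.p_fromOpcycles,
    reassoc_of% W.p_fromOpcycles]
  exact h.1

/-- The canonical morphism to `Z⁰` from the object coresolved by `W`. -/
noncomputable def Coresolution.toCycles (W : M.Coresolution A) :
    A ⟶ W.complex.cycles ((0 : ℕ) : ℤ) :=
  W.complex.liftCycles W.η 1 ((ComplexShape.up ℤ).next_eq' (by simp)) (by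
    have := W.epi
    rw [← cancel_epi W.ε, comp_zero, ← Category.assoc]
    exact (congrArg (· ≫ _) W.fac.symm).trans (W.complex.d_comp_d _ _ _))

lemma Coresolution.toCycles_i (W : M.Coresolution A) :
    W.toCycles ≫ W.complex.iCycles ((0 : ℕ) : ℤ) = W.η :=
  W.complex.liftCycles_i _ _ _ _

instance (W : M.Coresolution A) : IsIso W.toCycles := by
  have := W.mono
  have : Mono W.toCycles := mono_of_mono_fac W.toCycles_i
  have h : (ComplexShape.up ℤ).prev ((0 : ℕ) : ℤ) = -1 :=
    (ComplexShape.up ℤ).prev_eq' (by simp)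
  have hm : Epi (W.complex.toCycles (-1) ((0 : ℕ) : ℤ)) := by
    rw [← h]
    exact (W.exact _).epi_toCycles
  have hf : W.ε ≫ W.toCycles = W.complex.toCycles _ _ := by
    rw [← cancel_mono (W.complex.iCycles _), Category.assoc, W.toCycles_i,
      HomologicalComplex.toCycles_i]
    exact W.fac.symm
  have : Epi (W.ε ≫ W.toCycles) := hf ▸ hm
  have : Epi W.toCycles := epi_of_epi W.ε _
  exact isIso_of_mono_of_epi _

lemma Coresolution.Extends.comp_cyclesMap {W : M.Coresolution A} {W' : M.Coresolution B}
    {f : A ⟶ B} {β : W.complex ⟶ W'.complex} (h : W.Extends W' f β) :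
    W.toCycles ≫ cyclesMap β _ = f ≫ W'.toCycles := by
  rw [← cancel_mono (W'.complex.iCycles _), Category.assoc, Category.assoc, cyclesMap_i,
    W'.toCycles_i, reassoc_of% W.toCycles_i]
  exact h.2.symm

end AbelianModelStructure

end

/-! ### Replacements and Ext in a hereditary model structure -/

section

variable {C : Type u₁} [Category.{v₁} C] [Abelian C]

open Abelian

namespace ShortExtension

lemma exists_p_comp_eq {A B D : C} (S : ShortExtension A B) (f : S.Y ⟶ D) (hf : S.i ≫ f = 0) :
    ∃ g : A ⟶ D, S.p ≫ g = f := by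
  have : Epi (ShortComplex.mk S.i S.p S.w).g := S.exact.epi_g
  exact ⟨S.exact.exact.desc f hf, S.exact.exact.g_desc f hf⟩

/-- For an epimorphism `p` and a monomorphism `j` out of the same object, the short exact sequence
`0 ⟶ ker p ⟶ Y ⟶ Y ⊔ B ⟶ 0`. -/
noncomputable def kernelPushout {X Y B : C} (j : X ⟶ Y) (p : X ⟶ B) [Mono j] [Epi p] :
    ShortExtension (pushout j p) (kernel p) where
  Y := Y
  i := kernel.ι p ≫ j
  p := pushout.inl j p
  w := by rw [Category.assoc, pushout.condition, kernel.condition_assoc, zero_comp]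
  exact := by
    refine ShortComplex.ShortExact.mk' ?_ (mono_comp _ _)
      (inferInstanceAs (Epi (pushout.inl j p)))
    refine ShortComplex.exact_of_g_is_cokernel _ (CokernelCofork.IsColimit.ofπ' _ _ fun f hf => ?_)
    have hf' : kernel.ι p ≫ j ≫ f = 0 := (Category.assoc _ _ _).symm.trans hf
    have hp := ShortComplex.exact_kernel p
    have : Epi (ShortComplex.mk (kernel.ι p) p (kernel.condition p)).g := ‹Epi p›
    have hw : j ≫ f = p ≫ hp.desc (j ≫ f) hf' := (hp.g_desc (j ≫ f) hf').symm
    exact ⟨pushout.desc f _ hw, pushout.inl_desc _ _ _⟩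

section

variable [HasExt.{w} C] {A B : C} (S : ShortExtension A B) {D : C}

lemma precomp_i_bijective (hS : ∀ m : ℕ, Subsingleton (Ext.{w} A D (m + 1))) (n : ℕ) :
    Function.Bijective fun x : Ext.{w} S.Y D (n + 1) => (Ext.mk₀ S.i).comp x (zero_add _) := by
  constructor
  · intro x y h
    have h' : (Ext.mk₀ S.i).comp (x - y) (zero_add _) = 0 := by
      rw [sub_eq_add_neg, Ext.comp_add, Ext.comp_neg, add_neg_eq_zero]
      exact h
    obtain ⟨z, hz⟩ := S.exists_mk₀_p_comp_eq _ h'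
    have := hS n
    rw [← sub_eq_zero, ← hz, Subsingleton.elim z 0, Ext.comp_zero]
  · intro y
    have := hS (n + 1)
    exact S.exists_mk₀_i_comp_eq y (add_comm 1 _) (Subsingleton.elim _ _)

lemma postcomp_p_bijective (hS : ∀ m : ℕ, Subsingleton (Ext.{w} D B (m + 1))) (n : ℕ) :
    Function.Bijective fun x : Ext.{w} D S.Y (n + 1) => x.comp (Ext.mk₀ S.p) (add_zero _) := by
  constructor
  · intro x y h
    have h' : (x - y).comp (Ext.mk₀ S.p) (add_zero _) = 0 := by
      rw [sub_eq_add_neg, Ext.add_comp, Ext.neg_comp, add_neg_eq_zero]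
      exact h
    obtain ⟨z, hz⟩ := S.exists_comp_mk₀_i_eq _ h'
    have := hS n
    rw [← sub_eq_zero, ← hz, Subsingleton.elim z 0, Ext.zero_comp]
  · intro y
    have := hS (n + 1)
    exact S.exists_comp_mk₀_p_eq y rfl (Subsingleton.elim _ _)

lemma exists_i_comp_eq (hS : Subsingleton (Ext.{w} A D 1)) (f : B ⟶ D) :
    ∃ g : S.Y ⟶ D, S.i ≫ g = f :=
  (S.extClass_comp_mk₀_eq_zero_iff.{w} f).1 (Subsingleton.elim _ _)

end

end ShortExtension

namespace AbelianModelStructure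

variable {M : AbelianModelStructure C}

namespace IsHereditary

section

variable [HasExt.{w} C]

lemma subsingleton_ext_of_Q (hM : M.IsHereditary) {A B : C} (hA : M.Q A) (hB : M.RW B) (n : ℕ) :
    Subsingleton (Ext.{w} A B (n + 1)) :=
  (YonedaExt.subsingleton_iff n A B).1 (hM.1 A B hA hB (n + 1) (by lia))

lemma subsingleton_ext_of_R (hM : M.IsHereditary) {A B : C} (hA : M.QW A) (hB : M.R B) (n : ℕ) :
    Subsingleton (Ext.{w} A B (n + 1)) :=
  (YonedaExt.subsingleton_iff n A B).1 (hM.2 A B hA hB (n + 1) (by lia))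

end

variable (hM : M.IsHereditary)

include hM

/-- Fibrant objects are closed under cokernels of monomorphisms. -/
lemma fibrant_right {A B : C} (S : ShortExtension A B) (hB : M.R B) (hY : M.R S.Y) : M.R A := by
  let := HasExt.standard C
  rw [M.right_pair.right_iff]
  intro D hD
  rw [YonedaExt.subsingleton_iff.{max u₁ v₁} 0]
  refine subsingleton_of_forall_eq 0 fun x => ?_
  -- Ext¹(D, A) lies between Ext¹(D, Y) and Ext²(D, B); the vanishing of the latter is where
  -- heredity is needed.
  have := hM.subsingleton_ext_of_R.{max u₁ v₁} hD hB 1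
  have := hM.subsingleton_ext_of_R.{max u₁ v₁} hD hY 0
  obtain ⟨y, rfl⟩ := S.exists_comp_mk₀_p_eq x rfl (Subsingleton.elim _ _)
  rw [Subsingleton.elim y 0, Ext.zero_comp]

/-- Cofibrant objects are closed under extensions. -/
lemma cofibrant_middle {A B : C} (S : ShortExtension A B) (hA : M.Q A) (hB : M.Q B) : M.Q S.Y := by
  let := HasExt.standard C
  rw [M.left_pair.left_iff]
  intro D hD
  rw [YonedaExt.subsingleton_iff.{max u₁ v₁} 0]
  refine subsingleton_of_forall_eq 0 fun x => ?_
  have := hM.subsingleton_ext_of_Q.{max u₁ v₁} hA hD 0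
  have := hM.subsingleton_ext_of_Q.{max u₁ v₁} hB hD 0
  obtain ⟨y, rfl⟩ := S.exists_mk₀_p_comp_eq x (Subsingleton.elim _ _)
  rw [Subsingleton.elim y 0, Ext.comp_zero]

variable [HasExt.{w} C]

/-- A morphism between fibrant objects which vanishes on a subobject with trivially cofibrant
quotient acts as zero on `Ext` from cofibrant objects. -/
lemma comp_mk₀_eq_zero {X A B Y : C} (hX : M.Q X) (S : ShortExtension A B) (hA : M.QW A)
    (hY : M.R Y) (h : S.Y ⟶ Y) (hh : S.i ≫ h = 0) {n : ℕ} (x : Ext.{w} X S.Y (n + 1)) :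
    x.comp (Ext.mk₀ h) (add_zero _) = 0 := by
  obtain ⟨f, rfl⟩ := S.exists_p_comp_eq h hh
  -- A and the cokernel of i are both trivial, so the fibrant object I is trivially fibrant. The
  -- induced map A ⟶ Y extends to I because Y is fibrant and the cokernel trivially cofibrant, so h
  -- factors through I.
  obtain ⟨I, i, _, hI, hT⟩ := M.right_pair.enough_injectives A
  have hI' : M.RW I := ⟨M.thick₂ _ (ShortExtension.ofMono i).exact hA.2 hT.2, hI⟩
  obtain ⟨t, rfl⟩ : ∃ t : I ⟶ Y, i ≫ t = f := (ShortExtension.ofMono i).exists_i_comp_eq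
    (hM.subsingleton_ext_of_R.{w} hT hY 0) f
  have := hM.subsingleton_ext_of_Q.{w} hX hI' n
  rw [← Category.assoc, ← Ext.mk₀_comp_mk₀, ← Ext.comp_assoc_of_third_deg_zero,
    Subsingleton.elim (x.comp (Ext.mk₀ (S.p ≫ i)) (add_zero _)) 0, Ext.zero_comp]

/-- Additivity applied to f - g. On positive Ext from cofibrant objects, a map out of a fibrant
replacement is thus determined by its restriction to the replaced object, which makes the choice of
lifts immaterial. -/
lemma comp_mk₀_congr {X A B Y : C} (hX : M.Q X) (S : ShortExtension A B) (hA : M.QW A)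
    (hY : M.R Y) {f g : S.Y ⟶ Y} (h : S.i ≫ f = S.i ≫ g) {n : ℕ} (x : Ext.{w} X S.Y (n + 1)) :
    x.comp (Ext.mk₀ f) (add_zero _) = x.comp (Ext.mk₀ g) (add_zero _) := by
  have := hM.comp_mk₀_eq_zero hX S hA hY (f - g) (by rw [Preadditive.comp_sub, h, sub_self]) x
  rwa [sub_eq_add_neg, Ext.mk₀_add, Ext.comp_add, Ext.mk₀_neg, Ext.comp_neg,
    add_neg_eq_zero] at this

/-- Two fibrant replacements of the same object have the same `Ext` from cofibrant objects. -/
lemma postcomp_bijective_of_fibrant {X A A' B : C} (hX : M.Q X) (S : ShortExtension A B)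
    (S' : ShortExtension A' B) (hA : M.QW A) (hA' : M.QW A') (hS : M.R S.Y) (hS' : M.R S'.Y)
    (f : S.Y ⟶ S'.Y) (hf : S.i ≫ f = S'.i) (n : ℕ) :
    Function.Bijective fun x : Ext.{w} X S.Y (n + 1) => x.comp (Ext.mk₀ f) (add_zero _) := by
  obtain ⟨g, hg⟩ := S'.exists_i_comp_eq (hM.subsingleton_ext_of_R.{w} hA' hS 0) S.i
  refine Function.bijective_iff_has_inverse.2
    ⟨fun x => x.comp (Ext.mk₀ g) (add_zero _), fun x => ?_, fun x => ?_⟩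
  · dsimp only
    rw [Ext.comp_assoc_of_third_deg_zero, Ext.mk₀_comp_mk₀,
      hM.comp_mk₀_congr hX S hA hS (g := 𝟙 _) (by rw [reassoc_of% hf, hg, Category.comp_id]),
      Ext.comp_mk₀_id]
  · dsimp only
    rw [Ext.comp_assoc_of_third_deg_zero, Ext.mk₀_comp_mk₀,
      hM.comp_mk₀_congr hX S' hA' hS' (g := 𝟙 _) (by rw [reassoc_of% hg, hf, Category.comp_id]),
      Ext.comp_mk₀_id]

end IsHereditary

/-- The short exact sequence of a fibrant replacement. -/
noncomputable def FibrantReplacement.extension {B : C} (F : M.FibrantReplacement B) :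
    ShortExtension (cokernel F.j) B :=
  haveI := F.mono
  .ofMono F.j

section

variable [HasExt.{w} C]

/-- A lift `RQB ⟶ RB` of the replacement morphism `QB ⟶ B` is an isomorphism on `Ext` from cofibrant
objects. -/
lemma IsHereditary.postcomp_bijective_of_replacement (hM : M.IsHereditary) {X B : C} (hX : M.Q X)
    (q : M.CofibrantReplacement B) (rq : M.FibrantReplacement q.obj) (r : M.FibrantReplacement B)
    (f : rq.obj ⟶ r.obj) (hf : rq.j ≫ f = q.p ≫ r.j) (n : ℕ) :
    Function.Bijective fun x : Ext.{w} X rq.obj (n + 1) => x.comp (Ext.mk₀ f) (add_zero _) := by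
  have := q.epi
  have := rq.mono
  -- The pushout V is a quotient of RQB by a trivially fibrant kernel, hence fibrant, and an
  -- extension of the trivially cofibrant cokernel of `rq.j` by B. So B ⟶ V is another fibrant
  -- replacement of B.
  let S := ShortExtension.kernelPushout rq.j q.p
  have hV : M.R (pushout rq.j q.p) := hM.fibrant_right S q.trivFib.2 rq.fibrant
  have hf' : pushout.inl rq.j q.p ≫ pushout.desc f r.j hf = f := pushout.inl_desc _ _ _
  have h₁ := S.postcomp_p_bijective (hM.subsingleton_ext_of_Q.{w} hX q.trivFib) n
  have h₂ := hM.postcomp_bijective_of_fibrant.{w} hX (rq.extension.push q.p) r.extension rq.trivCof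
    r.trivCof hV r.fibrant (pushout.desc f r.j hf) (pushout.inr_desc _ _ _) n
  have h : (fun x : Ext.{w} X rq.obj (n + 1) => x.comp (Ext.mk₀ f) (add_zero _)) =
      fun x => (x.comp (Ext.mk₀ (pushout.inl rq.j q.p)) (add_zero _)).comp
        (Ext.mk₀ (pushout.desc f r.j hf)) (add_zero _) := by
    funext x
    rw [Ext.comp_assoc_of_third_deg_zero, Ext.mk₀_comp_mk₀, hf']
  rw [h]
  exact h₂.comp h₁

/-- Cohomology of `Hom(W, B)` for a resolution `W` of `A` and a fibrant object `B` computes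
`Ext(A, B)`. -/
noncomputable def Resolution.extEquiv (hM : M.IsHereditary) {A B : C} (W : M.Resolution A)
    (hB : M.R B) (n : ℕ) :
    LeftHomCohomology ((n + 1 : ℕ) : ℤ) W.complex B ≃+ Ext.{w} A B (n + 1) :=
  (leftHomCohomologyEquiv W.exact
    (fun k m => hM.subsingleton_ext_of_R (W.trivCof k (by simp)) hB m) n).trans
    (Ext.bimapEquiv (asIso W.fromOpcycles).symm (Iso.refl B) (n + 1))

lemma Resolution.extEquiv_map (hM : M.IsHereditary) {A A' B B' : C} (W : M.Resolution A)
    (W' : M.Resolution A') (hB : M.R B) (hB' : M.R B') (n : ℕ) {a : A' ⟶ A} (b : B ⟶ B')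
    {α : W'.complex ⟶ W.complex} (hα : W'.Extends W a α)
    (x : LeftHomCohomology ((n + 1 : ℕ) : ℤ) W.complex B) :
    W'.extEquiv.{w} hM hB' n (LeftHomCohomology.map _ α b x) =
      Ext.bimap a b (n + 1) (W.extEquiv hM hB n x) := by
  have h : inv W'.fromOpcycles ≫ HomologicalComplex.opcyclesMap α _ = a ≫ inv W.fromOpcycles := by
    rw [IsIso.inv_comp_eq, ← Category.assoc, IsIso.eq_comp_inv, hα.opcyclesMap_comp]
  change Ext.bimap (inv W'.fromOpcycles) (𝟙 B') _ (leftHomCohomologyEquiv _ _ _ _) =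
    Ext.bimap a b _ (Ext.bimap (inv W.fromOpcycles) (𝟙 B) _ (leftHomCohomologyEquiv _ _ _ _))
  rw [leftHomCohomologyEquiv_map W.exact W'.exact, ← Ext.bimap_apply, Ext.bimap_bimap,
    Ext.bimap_bimap, h, Category.comp_id, Category.id_comp]

/-- Cohomology of `Hom(A, W)` for a cofibrant object `A` and a coresolution `W` of `B` computes
`Ext(A, B)`. -/
noncomputable def Coresolution.extEquiv (hM : M.IsHereditary) {A B : C} (W : M.Coresolution B)
    (hA : M.Q A) (n : ℕ) :
    RightHomCohomology ((n + 1 : ℕ) : ℤ) A W.complex ≃+ Ext.{w} A B (n + 1) :=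
  (rightHomCohomologyEquiv W.exact
    (fun k m => hM.subsingleton_ext_of_Q hA (W.trivFib k (by simp)) m) n).trans
    (Ext.bimapEquiv (Iso.refl A) (asIso W.toCycles).symm (n + 1))

lemma Coresolution.extEquiv_map (hM : M.IsHereditary) {A A' B B' : C} (W : M.Coresolution B)
    (W' : M.Coresolution B') (hA : M.Q A) (hA' : M.Q A') (n : ℕ) (a : A' ⟶ A) {b : B ⟶ B'}
    {β : W.complex ⟶ W'.complex} (hβ : W.Extends W' b β)
    (x : RightHomCohomology ((n + 1 : ℕ) : ℤ) A W.complex) :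
    W'.extEquiv.{w} hM hA' n (RightHomCohomology.map _ a β x) =
      Ext.bimap a b (n + 1) (W.extEquiv hM hA n x) := by
  have h : HomologicalComplex.cyclesMap β _ ≫ inv W'.toCycles = inv W.toCycles ≫ b := by
    rw [IsIso.comp_inv_eq, Category.assoc, IsIso.eq_inv_comp, hβ.comp_cyclesMap]
  change Ext.bimap (𝟙 A') (inv W'.toCycles) _ (rightHomCohomologyEquiv _ _ _ _) =
    Ext.bimap a b _ (Ext.bimap (𝟙 A) (inv W.toCycles) _ (rightHomCohomologyEquiv _ _ _ _))
  rw [rightHomCohomologyEquiv_map W.exact W'.exact, ← Ext.bimap_apply, Ext.bimap_bimap,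
    Ext.bimap_bimap, h, Category.comp_id, Category.id_comp]

end

namespace ReplacementSystem

variable (D : M.ReplacementSystem)

/-- RQA is an extension of a trivially cofibrant object by QA. Its cofibrancy is needed for the
coresolution computation and for changing the second variable from RQB to RB. -/
lemma cofibrant_RQ (hM : M.IsHereditary) (A : C) : M.Q (D.R (D.Q A)) :=
  hM.cofibrant_middle (D.fib (D.Q A)).extension (D.fib (D.Q A)).trivCof.1 (D.cof A).cofibrant

lemma exists_comparison (hM : M.IsHereditary) (B : C) :
    ∃ f : D.R (D.Q B) ⟶ D.R B, (D.fib (D.Q B)).j ≫ f = (D.cof B).p ≫ (D.fib B).j := by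
  let := HasExt.standard C
  exact (D.fib (D.Q B)).extension.exists_i_comp_eq
    (hM.subsingleton_ext_of_R.{max u₁ v₁} (D.fib (D.Q B)).trivCof (D.fib B).fibrant 0) _

/-- A morphism `RQB ⟶ RB` compatible with the replacement morphism `QB ⟶ B`. -/
noncomputable def comparison (hM : M.IsHereditary) (B : C) : D.R (D.Q B) ⟶ D.R B :=
  (D.exists_comparison hM B).choose

lemma j_comparison (hM : M.IsHereditary) (B : C) :
    (D.fib (D.Q B)).j ≫ D.comparison hM B = (D.cof B).p ≫ (D.fib B).j :=
  (D.exists_comparison hM B).choose_spec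

variable [HasExt.{w} C]

/-- The isomorphism `Ext(RQA, RQB) ≃ Ext(QA, RB)` in positive degrees. -/
noncomputable def extEquiv (hM : M.IsHereditary) (A B : C) (n : ℕ) :
    Ext.{w} (D.R (D.Q A)) (D.R (D.Q B)) (n + 1) ≃+ Ext.{w} (D.Q A) (D.R B) (n + 1) :=
  AddEquiv.ofBijective (Ext.bimap (D.fib (D.Q A)).j (D.comparison hM B) (n + 1)) (by
    -- The second variable is changed first, with RQA cofibrant; then RQA is replaced by QA, with
    -- the target RB fibrant.
    have h₁ := (D.fib (D.Q A)).extension.precomp_i_bijective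
      (hM.subsingleton_ext_of_R.{w} (D.fib (D.Q A)).trivCof (D.fib B).fibrant) n
    have h₂ := hM.postcomp_bijective_of_replacement.{w} (D.cofibrant_RQ hM A) (D.cof B)
      (D.fib (D.Q B)) (D.fib B) _ (D.j_comparison hM B) n
    exact h₁.comp h₂)

lemma extEquiv_bimap (hM : M.IsHereditary) {A A' B B' : C} (n : ℕ) {f : A' ⟶ A} {g : B ⟶ B'}
    {qf : D.Q A' ⟶ D.Q A} {rqf : D.R (D.Q A') ⟶ D.R (D.Q A)} {qg : D.Q B ⟶ D.Q B'}
    {rqg : D.R (D.Q B) ⟶ D.R (D.Q B')} {rg : D.R B ⟶ D.R B'}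
    (hf : D.IsBifibrantLift f qf rqf) (hg : D.IsBifibrantLift g qg rqg)
    (hr : D.IsFibrantLift g rg) (x : Ext.{w} (D.R (D.Q A)) (D.R (D.Q B)) (n + 1)) :
    D.extEquiv hM A' B' n (Ext.bimap rqf rqg _ x) =
      Ext.bimap qf rg _ (D.extEquiv hM A B n x) := by
  -- The two maps RQB ⟶ RB' need not be equal. They agree on QB, which suffices by `comp_mk₀_congr`.
  have h : (D.fib (D.Q B)).j ≫ rqg ≫ D.comparison hM B' =
      (D.fib (D.Q B)).j ≫ D.comparison hM B ≫ rg := by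
    rw [reassoc_of% hg.2, D.j_comparison, reassoc_of% (D.j_comparison hM B), reassoc_of% hg.1,
      show (D.fib B).j ≫ rg = _ from hr]
  change Ext.bimap (D.fib (D.Q A')).j (D.comparison hM B') _ (Ext.bimap _ _ _ _) =
    Ext.bimap _ _ _ (Ext.bimap (D.fib (D.Q A)).j (D.comparison hM B) _ _)
  rw [Ext.bimap_bimap, Ext.bimap_bimap, hf.2, Ext.bimap_apply, Ext.bimap_apply]
  congr 1
  exact hM.comp_mk₀_congr (D.cofibrant_RQ hM A) (D.fib (D.Q B)).extension
    (D.fib (D.Q B)).trivCof (D.fib B').fibrant h x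

end ReplacementSystem

end AbelianModelStructure

end

/-! ### Transport to Yoneda groups -/

theorem mainTheorem4 {C : Type u} [Category.{v} C] [Abelian C]
    (M : AbelianModelStructure C) (hM : M.IsHereditary) (D : M.ReplacementSystem)
    (n : ℕ) (hn : 1 ≤ n) :
    ∃ (φ : ∀ A B : C, D.LeftExtHo n A B ≃+ D.YonedaExtHo n A B)
      (χ : ∀ A B : C, D.RightExtHo n A B ≃+ D.YonedaExtHo n A B)
      (ψ : ∀ A B : C, D.YonedaExtHo n A B ≃+ YonedaExt n (D.Q A) (D.R B)),
      -- naturality of `φ` with respect to all morphisms of bifibrant replacements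
      (∀ (A A' B B' : C) (a : D.R (D.Q A') ⟶ D.R (D.Q A)) (b : D.R (D.Q B) ⟶ D.R (D.Q B'))
        (α : (D.res A').complex ⟶ (D.res A).complex),
        (D.res A').Extends (D.res A) a α →
        ∀ x : D.LeftExtHo n A B,
          φ A' B' (LeftHomCohomology.map n α b x) = YonedaExt.map a b (φ A B x)) ∧
      -- naturality of `χ` with respect to all morphisms of bifibrant replacements
      (∀ (A A' B B' : C) (a : D.R (D.Q A') ⟶ D.R (D.Q A)) (b : D.R (D.Q B) ⟶ D.R (D.Q B'))
        (β : (D.cores B).complex ⟶ (D.cores B').complex),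
        (D.cores B).Extends (D.cores B') b β →
        ∀ x : D.RightExtHo n A B,
          χ A' B' (RightHomCohomology.map n a β x) = YonedaExt.map a b (χ A B x)) ∧
      -- naturality of `ψ` with respect to all morphisms of `C`
      (∀ (A A' B B' : C) (f : A' ⟶ A) (g : B ⟶ B')
        (qf : D.Q A' ⟶ D.Q A) (rqf : D.R (D.Q A') ⟶ D.R (D.Q A))
        (qg : D.Q B ⟶ D.Q B') (rqg : D.R (D.Q B) ⟶ D.R (D.Q B')) (rg : D.R B ⟶ D.R B'),
        D.IsBifibrantLift f qf rqf → D.IsBifibrantLift g qg rqg → D.IsFibrantLift g rg →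
        ∀ x : D.YonedaExtHo n A B,
          ψ A' B' (YonedaExt.map rqf rqg x) = YonedaExt.map qf rg (ψ A B x)) := by
  let : HasExt.{max u v} C := HasExt.standard C
  -- Classes in `YonedaExt (m + 1)` are represented by `NFoldExtension m`, whose index is one less
  -- than the degree.
  obtain ⟨m, rfl⟩ : ∃ m, n = m + 1 := ⟨n - 1, by lia⟩
  let Y := YonedaExt.extEquiv.{max u v} (C := C) m
  have hY : ∀ {A A' B B' : C} (a : A' ⟶ A) (b : B ⟶ B') (x : Abelian.Ext.{max u v} A B (m + 1)),
      (Y A' B').symm (Abelian.Ext.bimap a b _ x) = YonedaExt.map a b ((Y A B).symm x) := by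
    intro A A' B B' a b x
    rw [AddEquiv.symm_apply_eq, YonedaExt.extEquiv_map, AddEquiv.apply_symm_apply]
  refine ⟨fun A B => ((D.res A).extEquiv hM (D.fib (D.Q B)).fibrant m).trans (Y _ _).symm,
    fun A B => ((D.cores B).extEquiv hM (D.cofibrant_RQ hM A) m).trans (Y _ _).symm,
    fun A B => ((Y _ _).trans (D.extEquiv hM A B m)).trans (Y _ _).symm, ?_, ?_, ?_⟩
  · intro A A' B B' a b α hα x
    refine Eq.trans ?_ (hY _ _ _)
    exact congrArg (Y _ _).symm ((D.res A).extEquiv_map hM (D.res A') _ _ m b hα x)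
  · intro A A' B B' a b β hβ x
    refine Eq.trans ?_ (hY _ _ _)
    exact congrArg (Y _ _).symm ((D.cores B).extEquiv_map hM (D.cores B') _ _ m a hβ x)
  · intro A A' B B' f g qf rqf qg rqg rg hf hg hr x
    refine Eq.trans ?_ (hY _ _ _)
    refine congrArg (Y _ _).symm (Eq.trans ?_ (D.extEquiv_bimap hM m hf hg hr _))
    exact congrArg (D.extEquiv hM A' B' m) (YonedaExt.extEquiv_map _ _ _ _)
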